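/- \textbf{Model.} There are $n\ge 1$ candidates; candidate $i\in[n]$ has a receiver utility $\rho_i\ge 0$ and a sender utility $\xi_i\ge 0$. All pairs $(\rho_i,\xi_i)$ are known in advance to both players. The candidates arrive in uniformly random order, one per round; $\theta_t$ is the candidate of round $t$. In round $t$ the sender sees $\theta_t$ and sends a signal $\sigma_t\in\{\mathrm{HIRE},\mathrm{NOT}\}$, according to a randomized mechanism to which she commits in advance and which may depend on $\theta_1,\dots,\theta_t$ and $\sigma_1,\dots,\sigma_{t-1}$. The receiver then irrevocably hires the current candidate (which ends the process) or rejects it. When deciding in round $t$ she knows $\sigma_1,\dots,\sigma_t$ and, in the scenario \emph{with disclosure}, also the rejected candidates $\theta_1,\dots,\theta_{t-1}$; she does not know $\theta_t$. If candidate $i$ is hired the players get $\rho_i$ and $\xi_i$; if nobody is hired both get $0$. A mechanism is \emph{persuasive} if in every round $t$ with $\sigma_1=\dots=\sigma_{t-1}=\mathrm{NOT}$, given all her information (including $\sigma_t$), the receiver maximizes her conditional expected utility over all strategies by obeying the signals from then on (hire upon the first $\mathrm{HIRE}$, never upon $\mathrm{NOT}$). Let $\mathrm{OPT}$ be the optimal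 (supremal) expected utility of the sender, with an obedient receiver, over all persuasive mechanisms in the scenario \emph{without} disclosure (the benchmark scenario). \textbf{Pareto procedure} on a nonempty set $C$ of candidates. Let $\mu=\frac1{|C|}\sum_{i\in C}\rho_i$, and let $c\in C$ maximize $\xi$ over $C$. If $\rho_c\ge\mu$, set $a=b=c$. Otherwise choose $a,b\in C$ with $\rho_a\le\mu\le\rho_b$ such that the segment from $(\rho_a,\xi_a)$ to $(\rho_b,\xi_b)$ lies on the Pareto frontier of $\mathrm{conv}\{(\rho_i,\xi_i): i\in C\}$, i.e. no point of the hull is strictly larger in both coordinates than a point of the segment. Let $\alpha=1$ if $\rho_a=\rho_b$; $\alpha=0$ if $\rho_a\neq\rho_b$ and $\xi_a=\xi_b$; and $\alpha=\frac{\mu-\rho_b}{\rho_a-\rho_b}$ otherwise. Return $a$ with probability $\alpha$ and $b$ with probability $1-\alpha$. Ties in the choice of $c,a,b$ are resolved by an arbitrary fixed rule. \textbf{Shrinking Pareto mechanism.} In round $t$, as long as no $\mathrm{HIRE}$ has been sent, run the Pareto procedure with fresh randomness on the set $R_t=[n]\setminus\{\theta_1,\dots,\theta_{t-1}\}$ of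 remaining candidates; signal $\mathrm{HIRE}$ if it returns $\theta_t$, and $\mathrm{NOT}$ otherwise. After a $\mathrm{HIRE}$ signal, signal $\mathrm{NOT}$ in all later rounds. \textbf{Theorem.} There is a sequence $\delta_n\to 0$ such that for every $n\ge 1$ and every instance $(\rho_i,\xi_i)_{i\in[n]}$ with nonnegative values, the Shrinking Pareto mechanism (with any tie-breaking rule) is persuasive in the scenario with disclosure, and with an obedient receiver it gives the sender expected utility at least $\left(\frac13-\delta_n\right)\mathrm{OPT}$. -/

import Mathlib

namespace OnlinePersuasion

/-! Candidates are the elements of `Fin n`; candidate `i` has receiver utility `ρ i` and sender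
utility `ξ i`. An arrival order is a permutation `θ` (candidate `θ t` arrives in round `t`), drawn
uniformly at random. A signal vector is `σ : Fin n → Bool`, with `true` for HIRE and `false` for
NOT. -/

/-- A randomized direct signaling mechanism (for a sender who knows all valuations):
`hireProb t θ σ` is the probability of the signal HIRE in round `t`, given the candidates that
arrived in rounds `≤ t` and the signals sent in rounds `< t`. -/
structure DirectMechanism (n : ℕ) where
  hireProb : Fin n → Equiv.Perm (Fin n) → (Fin n → Bool) → ℝ
  nonneg : ∀ t θ σ, 0 ≤ hireProb t θ σ
  le_one : ∀ t θ σ, hireProb t θ σ ≤ 1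
  causal : ∀ t θ θ' σ σ', (∀ s, s ≤ t → θ s = θ' s) → (∀ s, s < t → σ s = σ' s) →
    hireProb t θ σ = hireProb t θ' σ'

/-- Joint probability of the arrival order `θ` (uniform) and the signals `σ` that the mechanism
sends as long as the receiver keeps rejecting. -/
noncomputable def DirectMechanism.law {n : ℕ} (φ : DirectMechanism n)
    (θ : Equiv.Perm (Fin n)) (σ : Fin n → Bool) : ℝ :=
  1 / (n.factorial : ℝ) *
    ∏ t, (if σ t = true then φ.hireProb t θ σ else 1 - φ.hireProb t θ σ)

/-- The receiver has the same information when she decides in round `t`: she has seen the signals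
of rounds `≤ t` and, with disclosure, the candidates she rejected in rounds `< t`. -/
def SameInfo {n : ℕ} (disclosure : Bool) (t : Fin n) (θ θ' : Equiv.Perm (Fin n))
    (σ σ' : Fin n → Bool) : Prop :=
  (∀ s, s ≤ t → σ s = σ' s) ∧ (disclosure = true → ∀ s, s < t → θ s = θ' s)

/-- A strategy of the receiver: hire (`true`) or reject in round `t`, depending only on what she
knows in that round. -/
structure ReceiverStrategy (n : ℕ) (disclosure : Bool) where
  hires : Fin n → Equiv.Perm (Fin n) → (Fin n → Bool) → Bool
  adapted : ∀ t θ θ' σ σ', SameInfo disclosure t θ θ' σ σ' → hires t θ σ = hires t θ' σ'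

/-- Always follow the signal. -/
def obedient (n : ℕ) (disclosure : Bool) : ReceiverStrategy n disclosure where
  hires t _ σ := σ t
  adapted t _ _ _ _ h := h.1 t le_rfl

/-- The utility `u` of the candidate hired when the process has reached round `t₀` and the receiver
uses `d` from round `t₀` on: that of the first candidate hired, and `0` if nobody gets hired. -/
noncomputable def payoffFrom {n : ℕ} {disclosure : Bool} (u : Fin n → ℝ)
    (d : ReceiverStrategy n disclosure) (t₀ : Fin n) (θ : Equiv.Perm (Fin n))
    (σ : Fin n → Bool) : ℝ :=
  open Classical in
  ∑ t, if t₀ ≤ t ∧ d.hires t θ σ = true ∧ (∀ s, t₀ ≤ s → s < t → d.hires s θ σ = false)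
    then u (θ t) else 0

/-- Expected utility of the receiver from using `d` from round `t` on, restricted to the event that
her information in round `t` is the one given by `(θ₀, σ₀)`. This is the conditional expected
utility times the probability of that event. -/
noncomputable def utilityAt {n : ℕ} {disclosure : Bool} (ρ : Fin n → ℝ) (φ : DirectMechanism n)
    (d : ReceiverStrategy n disclosure) (t : Fin n) (θ₀ : Equiv.Perm (Fin n))
    (σ₀ : Fin n → Bool) : ℝ :=
  open Classical in
  ∑ θ, ∑ σ, if SameInfo disclosure t θ₀ θ σ₀ σ then φ.law θ σ * payoffFrom ρ d t θ σ else 0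

/-- In every round `t` that an obedient receiver can reach (all earlier signals were NOT), whatever
her information including the current signal, obedience maximizes her conditional expected utility
over all strategies. -/
def Persuasive {n : ℕ} (disclosure : Bool) (ρ : Fin n → ℝ) (φ : DirectMechanism n) : Prop :=
  ∀ (t : Fin n) (θ₀ : Equiv.Perm (Fin n)) (σ₀ : Fin n → Bool), (∀ s, s < t → σ₀ s = false) →
    ∀ d : ReceiverStrategy n disclosure,
      utilityAt ρ φ d t θ₀ σ₀ ≤ utilityAt ρ φ (obedient n disclosure) t θ₀ σ₀

/-- Utility `u` of the candidate hired by an obedient receiver: the first one with signal HIRE. -/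
noncomputable def obedientPayoff {n : ℕ} (u : Fin n → ℝ) (θ : Equiv.Perm (Fin n))
    (σ : Fin n → Bool) : ℝ :=
  open Classical in
  ∑ t, if σ t = true ∧ (∀ s, s < t → σ s = false) then u (θ t) else 0

/-- Expected utility of the sender when the receiver is obedient. -/
noncomputable def senderUtility {n : ℕ} (ξ : Fin n → ℝ) (φ : DirectMechanism n) : ℝ :=
  ∑ θ, ∑ σ, φ.law θ σ * obedientPayoff ξ θ σ

/-- The values that persuasive mechanisms give to the sender in the benchmark scenario, where
rejected candidates are not disclosed. -/
def benchmarkValues {n : ℕ} (ρ ξ : Fin n → ℝ) : Set ℝ :=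
  {v | ∃ φ : DirectMechanism n, Persuasive false ρ φ ∧ senderUtility ξ φ = v}

/-- The optimum of the benchmark scenario. -/
noncomputable def benchmarkOpt {n : ℕ} (ρ ξ : Fin n → ℝ) : ℝ := sSup (benchmarkValues ρ ξ)

/-! ### The Pareto procedure -/

/-- The average receiver utility of the candidates in `C`. -/
noncomputable def receiverMean {n : ℕ} (ρ : Fin n → ℝ) (C : Finset (Fin n)) : ℝ :=
  (∑ i ∈ C, ρ i) / (C.card : ℝ)

/-- The convex hull of the valuation pairs of the candidates in `C`. -/
def valuationHull {n : ℕ} (ρ ξ : Fin n → ℝ) (C : Finset (Fin n)) : Set (ℝ × ℝ) :=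
  convexHull ℝ ((fun i => (ρ i, ξ i)) '' (C : Set (Fin n)))

/-- The Pareto frontier (upper right boundary) of the convex hull: the points for which no point of
the hull is better for both players. -/
def paretoFrontier {n : ℕ} (ρ ξ : Fin n → ℝ) (C : Finset (Fin n)) : Set (ℝ × ℝ) :=
  {p | p ∈ valuationHull ρ ξ C ∧ ∀ q ∈ valuationHull ρ ξ C, ¬ (p.1 < q.1 ∧ p.2 < q.2)}

/-- `a, b` is a possible choice of the Pareto procedure on `C`: with `c` a sender-optimal candidate,
`a = b = c` if `c` gives the receiver at least the mean, and otherwise `a` and `b` are the ends of a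
segment of the Pareto frontier that meets the vertical line at the mean. -/
def IsParetoPair {n : ℕ} (ρ ξ : Fin n → ℝ) (C : Finset (Fin n)) (a b : Fin n) : Prop :=
  ∃ c ∈ C, (∀ i ∈ C, ξ i ≤ ξ c) ∧
    ((receiverMean ρ C ≤ ρ c ∧ a = c ∧ b = c) ∨
      (ρ c < receiverMean ρ C ∧ a ∈ C ∧ b ∈ C ∧
        ρ a ≤ receiverMean ρ C ∧ receiverMean ρ C ≤ ρ b ∧
        segment ℝ (ρ a, ξ a) (ρ b, ξ b) ⊆ paretoFrontier ρ ξ C))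

/-- The Pareto procedure, with some way to resolve ties: for every nonempty set of candidates it
fixes a pair `a, b`. -/
structure ParetoProcedure {n : ℕ} (ρ ξ : Fin n → ℝ) where
  a : Finset (Fin n) → Fin n
  b : Finset (Fin n) → Fin n
  isParetoPair : ∀ C : Finset (Fin n), C.Nonempty → IsParetoPair ρ ξ C (a C) (b C)

/-- Probability with which the procedure returns `a` instead of `b`. -/
noncomputable def ParetoProcedure.alpha {n : ℕ} {ρ ξ : Fin n → ℝ} (P : ParetoProcedure ρ ξ)
    (C : Finset (Fin n)) : ℝ :=
  open Classical in
  if ρ (P.a C) = ρ (P.b C) then 1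
  else if ξ (P.a C) = ξ (P.b C) then 0
  else (receiverMean ρ C - ρ (P.b C)) / (ρ (P.a C) - ρ (P.b C))

/-- Probability that the candidate returned by the procedure on input `C` is `i`. -/
noncomputable def ParetoProcedure.returnProb {n : ℕ} {ρ ξ : Fin n → ℝ} (P : ParetoProcedure ρ ξ)
    (C : Finset (Fin n)) (i : Fin n) : ℝ :=
  (if i = P.a C then P.alpha C else 0) + (if i = P.b C then 1 - P.alpha C else 0)

theorem ParetoProcedure.alpha_mem {n : ℕ} {ρ ξ : Fin n → ℝ} (P : ParetoProcedure ρ ξ)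
    (C : Finset (Fin n)) (hC : C.Nonempty) : 0 ≤ P.alpha C ∧ P.alpha C ≤ 1 := by
  unfold ParetoProcedure.alpha
  split_ifs with h1 h2
  · simp
  · simp
  · obtain ⟨c, -, -, ⟨-, ha, hb⟩ | ⟨-, -, -, h3, h4, -⟩⟩ := P.isParetoPair C hC
    · exact absurd (by rw [ha, hb]) h1
    · have h5 : ρ (P.a C) - ρ (P.b C) < 0 :=
        sub_neg.2 (lt_of_le_of_ne (h3.trans h4) h1)
      constructor
      · exact div_nonneg_of_nonpos (by linarith) h5.le
      · rw [div_le_one_of_neg h5]; linarith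

theorem ParetoProcedure.returnProb_mem {n : ℕ} {ρ ξ : Fin n → ℝ} (P : ParetoProcedure ρ ξ)
    (C : Finset (Fin n)) (hC : C.Nonempty) (i : Fin n) :
    0 ≤ P.returnProb C i ∧ P.returnProb C i ≤ 1 := by
  obtain ⟨h1, h2⟩ := P.alpha_mem C hC
  unfold ParetoProcedure.returnProb
  split_ifs <;> constructor <;> linarith

/-- The candidates that have not arrived before round `t`. -/
def remaining {n : ℕ} (t : Fin n) (θ : Equiv.Perm (Fin n)) : Finset (Fin n) :=
  Finset.univ.filter (fun i => ∀ s, s < t → θ s ≠ i)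

theorem mem_remaining {n : ℕ} (t : Fin n) (θ : Equiv.Perm (Fin n)) : θ t ∈ remaining t θ := by
  simp only [remaining, Finset.mem_filter, Finset.mem_univ, true_and]
  intro s hs h
  exact hs.ne (θ.injective h)

/-- The Shrinking Pareto mechanism: as long as no HIRE has been signaled, run the Pareto procedure
with fresh randomness on the set of remaining candidates, and signal HIRE exactly if it returns the
candidate that arrives in the current round. After a HIRE, signal NOT forever. -/
noncomputable def ParetoProcedure.shrinkingPareto {n : ℕ} {ρ ξ : Fin n → ℝ}
    (P : ParetoProcedure ρ ξ) : DirectMechanism n where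
  hireProb t θ σ :=
    open Classical in
    if ∃ s, s < t ∧ σ s = true then 0 else P.returnProb (remaining t θ) (θ t)
  nonneg t θ σ := by
    split_ifs
    · exact le_rfl
    · exact (P.returnProb_mem _ ⟨_, mem_remaining t θ⟩ _).1
  le_one t θ σ := by
    split_ifs
    · exact zero_le_one
    · exact (P.returnProb_mem _ ⟨_, mem_remaining t θ⟩ _).2
  causal t θ θ' σ σ' hθ hσ := by
    have h1 : (∃ s, s < t ∧ σ s = true) ↔ (∃ s, s < t ∧ σ' s = true) := by
      constructor <;> rintro ⟨s, hs, h⟩ <;> refine ⟨s, hs, ?_⟩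
      · rw [← hσ s hs]; exact h
      · rw [hσ s hs]; exact h
    have h2 : remaining t θ = remaining t θ' := by
      ext i
      simp only [remaining, Finset.mem_filter, Finset.mem_univ, true_and]
      refine forall_congr' fun s => forall_congr' fun hs => ?_
      rw [hθ s hs.le]
    simp only [h1, h2, hθ t le_rfl]

/-! ### The notions are well defined -/

/-- A non-increasing line above all valuation pairs carries a part of the Pareto frontier. -/
theorem segment_subset_paretoFrontier {n : ℕ} {ρ ξ : Fin n → ℝ} {C : Finset (Fin n)} {a b : Fin n}
    (ha : a ∈ C) (hb : b ∈ C) (m k : ℝ) (hm : m ≤ 0) (hC : ∀ i ∈ C, ξ i - m * ρ i ≤ k)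
    (hka : ξ a - m * ρ a = k) (hkb : ξ b - m * ρ b = k) :
    segment ℝ (ρ a, ξ a) (ρ b, ξ b) ⊆ paretoFrontier ρ ξ C := by
  have hull : ∀ q ∈ valuationHull ρ ξ C, q.2 - m * q.1 ≤ k := by
    have hconv : Convex ℝ {q : ℝ × ℝ | q.2 - m * q.1 ≤ k} := by
      intro x hx y hy s t hs ht hst
      simp only [Set.mem_ofPred_eq, Prod.snd_add, Prod.smul_snd, Prod.fst_add, Prod.smul_fst,
        smul_eq_mul] at hx hy ⊢
      obtain rfl : t = 1 - s := by linarith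
      nlinarith
    intro q hq
    refine convexHull_min ?_ hconv hq
    rintro _ ⟨i, hi, rfl⟩
    exact hC i (by simpa using hi)
  intro p hp
  have mem : ∀ i ∈ C, (ρ i, ξ i) ∈ (fun i => (ρ i, ξ i)) '' (C : Set (Fin n)) :=
    fun i hi => ⟨i, by simpa using hi, rfl⟩
  refine ⟨segment_subset_convexHull (mem a ha) (mem b hb) hp, ?_⟩
  rintro q hq ⟨h1, h2⟩
  have h3 := hull q hq
  obtain ⟨s, t, hs, ht, hst, rfl⟩ := hp
  simp only [Prod.snd_add, Prod.smul_snd, Prod.fst_add, Prod.smul_fst, smul_eq_mul] at h1 h2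
  obtain rfl : t = 1 - s := by linarith
  have h4 : (s * ξ a + (1 - s) * ξ b) - m * (s * ρ a + (1 - s) * ρ b) = k := by
    linear_combination s * hka + (1 - s) * hkb
  nlinarith

theorem exists_isParetoPair {n : ℕ} (ρ ξ : Fin n → ℝ) (C : Finset (Fin n)) (hC : C.Nonempty) :
    ∃ a b, IsParetoPair ρ ξ C a b := by
  classical
  obtain ⟨c, hc, hmax⟩ := C.exists_max_image ξ hC
  set μ := receiverMean ρ C with hμ
  rcases le_or_gt μ (ρ c) with h | h
  · exact ⟨c, c, c, hc, hmax, Or.inl ⟨h, rfl, rfl⟩⟩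
  have hcard : (0 : ℝ) < C.card := by exact_mod_cast hC.card_pos
  have hright : ∃ j ∈ C, μ ≤ ρ j := by
    by_contra! hcon
    have : ∑ i ∈ C, ρ i < ∑ _i ∈ C, μ := Finset.sum_lt_sum_of_nonempty hC hcon
    rw [Finset.sum_const, nsmul_eq_mul, hμ, receiverMean, mul_div_cancel₀ _ hcard.ne'] at this
    exact lt_irrefl _ this
  obtain ⟨j₀, hj₀, hj₀μ⟩ := hright
  let L := C.filter fun i => ρ i < μ
  let R := C.filter fun i => μ ≤ ρ i
  have hcL : c ∈ L := by simp [L, hc, h]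
  have hjR : j₀ ∈ R := by simp [R, hj₀, hj₀μ]
  -- the height over `μ` of the chord from `i` to `j`
  let v : Fin n × Fin n → ℝ := fun p =>
    ξ p.1 + (ξ p.2 - ξ p.1) * ((μ - ρ p.1) / (ρ p.2 - ρ p.1))
  obtain ⟨⟨a₀, b⟩, hab, hv⟩ := (L ×ˢ R).exists_max_image v ⟨(c, j₀), by simp [hcL, hjR]⟩
  set V := v (a₀, b) with hV
  obtain ⟨a, haL, ha⟩ := L.exists_min_image (fun i => (V - ξ i) / (μ - ρ i)) ⟨c, hcL⟩
  set m := (V - ξ a) / (μ - ρ a) with hm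
  simp only [Finset.mem_product] at hab
  have memL : ∀ {i}, i ∈ L ↔ i ∈ C ∧ ρ i < μ := by simp [L]
  have memR : ∀ {i}, i ∈ R ↔ i ∈ C ∧ μ ≤ ρ i := by simp [R]
  have key : ∀ i j, ρ i < μ → μ ≤ ρ j →
      v (i, j) * (ρ j - ρ i) = ξ i * (ρ j - μ) + ξ j * (μ - ρ i) := by
    intro i j hi hj
    have : ρ j - ρ i ≠ 0 := by linarith
    simp only [v]
    field_simp
    ring
  obtain ⟨haC, haμ⟩ := memL.1 haL
  obtain ⟨ha₀C, ha₀μ⟩ := memL.1 hab.1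
  obtain ⟨hbC, hbμ⟩ := memR.1 hab.2
  have hma : m * (μ - ρ a) = V - ξ a := div_mul_cancel₀ _ (by linarith)
  have hle : ∀ i, i ∈ L → m * (μ - ρ i) ≤ V - ξ i := fun i hi =>
    (le_div_iff₀ (by linarith [(memL.1 hi).2])).1 (ha i hi)
  have hVij : ∀ i j, i ∈ L → j ∈ R → ξ i * (ρ j - μ) + ξ j * (μ - ρ i) ≤ V * (ρ j - ρ i) := by
    intro i j hi hj
    rw [← key i j (memL.1 hi).2 (memR.1 hj).2]
    exact mul_le_mul_of_nonneg_right (hv (i, j) (by simp [hi, hj]))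
      (by linarith [(memL.1 hi).2, (memR.1 hj).2])
  have hVab := key a₀ b ha₀μ hbμ
  have hVc : V ≤ ξ c := by
    have h1 := hmax a₀ ha₀C
    have h2 := hmax b hbC
    nlinarith
  have hm0 : m ≤ 0 := by
    have := hle c hcL
    nlinarith
  -- every valuation pair lies below the line of slope `m` through `(μ, V)`
  have hbelow : ∀ i ∈ C, ξ i - m * ρ i ≤ V - m * μ := by
    intro i hi
    rcases lt_or_ge (ρ i) μ with hiμ | hiμ
    · have := hle i (memL.2 ⟨hi, hiμ⟩)
      linarith
    · have := hVij a i haL (memR.2 ⟨hi, hiμ⟩)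
      have h3 : 0 < μ - ρ a := by linarith
      by_contra! hcon
      nlinarith
  have hbeq : ξ b - m * ρ b = V - m * μ := by
    refine le_antisymm (hbelow b hbC) ?_
    have := hle a₀ hab.1
    have h3 : 0 < μ - ρ a₀ := by linarith
    by_contra! hcon
    nlinarith
  refine ⟨a, b, c, hc, hmax, Or.inr ⟨h, haC, hbC, haμ.le, hbμ, ?_⟩⟩
  exact segment_subset_paretoFrontier haC hbC m (V - m * μ) hm0 hbelow (by linarith) hbeq

/-- The Pareto procedure exists. -/
theorem nonempty_paretoProcedure {n : ℕ} (hn : 0 < n) (ρ ξ : Fin n → ℝ) :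
    Nonempty (ParetoProcedure ρ ξ) := by
  classical
  choose a b hab using exists_isParetoPair ρ ξ
  exact ⟨⟨fun C => if h : C.Nonempty then a C h else ⟨0, hn⟩,
    fun C => if h : C.Nonempty then b C h else ⟨0, hn⟩, fun C h => by simpa [h] using hab C h⟩⟩

/-- Always signal HIRE. -/
def alwaysHire (n : ℕ) : DirectMechanism n where
  hireProb _ _ _ := 1
  nonneg _ _ _ := zero_le_one
  le_one _ _ _ := le_rfl
  causal _ _ _ _ _ _ _ := rfl

theorem law_alwaysHire {n : ℕ} (θ : Equiv.Perm (Fin n)) (σ : Fin n → Bool) :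
    (alwaysHire n).law θ σ = if σ = (fun _ => true) then 1 / (n.factorial : ℝ) else 0 := by
  unfold DirectMechanism.law
  split_ifs with h
  · subst h; simp [alwaysHire]
  · obtain ⟨t, ht⟩ : ∃ t, σ t ≠ true := by
      by_contra! hcon; exact h (funext hcon)
    rw [Finset.prod_eq_zero (Finset.mem_univ t), mul_zero]
    simp [ht, alwaysHire]

theorem persuasive_alwaysHire {n : ℕ} (ρ : Fin n → ℝ) (hρ : ∀ i, 0 ≤ ρ i) :
    Persuasive false ρ (alwaysHire n) := by
  classical
  intro t θ₀ σ₀ _ d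
  have key : ∑ θ, payoffFrom ρ d t θ (fun _ => true) ≤
      ∑ θ, payoffFrom ρ (obedient n false) t θ (fun _ => true) := by
    have hob : ∀ θ, payoffFrom ρ (obedient n false) t θ (fun _ => true) = ρ (θ t) := by
      intro θ
      unfold payoffFrom
      rw [Finset.sum_eq_single t]
      · rw [if_pos ⟨le_rfl, rfl, fun s h1 h2 => absurd h1 (not_le.2 h2)⟩]
      · intro s _ hs
        refine if_neg ?_
        rintro ⟨h1, -, h2⟩
        exact absurd (h2 t le_rfl (lt_of_le_of_ne h1 (Ne.symm hs))) (by simp [obedient])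
      · simp
    have hd : ∀ s θ, d.hires s θ (fun _ => true) = d.hires s θ₀ (fun _ => true) :=
      fun s θ => d.adapted _ _ _ _ _ ⟨fun _ _ => rfl, by simp⟩
    have hK : ∀ s, ∑ θ : Equiv.Perm (Fin n), ρ (θ s) = ∑ θ : Equiv.Perm (Fin n), ρ (θ t) := by
      intro s
      exact Fintype.sum_equiv (Equiv.mulRight (Equiv.swap s t)) _ _ (by simp)
    simp only [hob]
    unfold payoffFrom
    simp only [hd]
    rw [Finset.sum_comm]
    by_cases hex : ∃ s, t ≤ s ∧ d.hires s θ₀ (fun _ => true) = true ∧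
        ∀ r, t ≤ r → r < s → d.hires r θ₀ (fun _ => true) = false
    · obtain ⟨s, hs⟩ := hex
      rw [Finset.sum_eq_single s]
      · simp only [if_pos hs]
        exact (hK s).le
      · intro r _ hr
        have : ¬ (t ≤ r ∧ d.hires r θ₀ (fun _ => true) = true ∧
            ∀ q, t ≤ q → q < r → d.hires q θ₀ (fun _ => true) = false) := by
          rintro ⟨h1, h2, h3⟩
          rcases lt_or_gt_of_ne hr with h | h
          · simpa [h2] using hs.2.2 r h1 h
          · simpa [hs.2.1] using h3 s hs.1 h
        simp [if_neg this]
      · simp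
    · push Not at hex
      have : ∀ r, ¬ (t ≤ r ∧ d.hires r θ₀ (fun _ => true) = true ∧
            ∀ q, t ≤ q → q < r → d.hires q θ₀ (fun _ => true) = false) := by
        rintro r ⟨h1, h2, h3⟩
        obtain ⟨q, h4, h5, h6⟩ := hex r h1 h2
        exact h6 (h3 q h4 h5)
      simp only [if_neg (this _), Finset.sum_const_zero]
      exact Finset.sum_nonneg fun θ _ => hρ _
  have red : ∀ d : ReceiverStrategy n false, utilityAt ρ (alwaysHire n) d t θ₀ σ₀ =
      if (∀ s, s ≤ t → σ₀ s = true) then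
        1 / (n.factorial : ℝ) * ∑ θ, payoffFrom ρ d t θ (fun _ => true) else 0 := by
    intro d
    unfold utilityAt
    have : ∀ θ, (∑ σ, if SameInfo false t θ₀ θ σ₀ σ then
        (alwaysHire n).law θ σ * payoffFrom ρ d t θ σ else 0) =
        if (∀ s, s ≤ t → σ₀ s = true) then
          1 / (n.factorial : ℝ) * payoffFrom ρ d t θ (fun _ => true) else 0 := by
      intro θ
      rw [Finset.sum_eq_single (fun _ => true)]
      · simp [SameInfo, law_alwaysHire]
      · intro σ _ hσ
        simp [law_alwaysHire, hσ]
      · simp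
    simp only [this]
    split_ifs
    · rw [Finset.mul_sum]
    · simp
  rw [red, red]
  split_ifs
  · exact mul_le_mul_of_nonneg_left key (by positivity)
  · exact le_rfl

theorem bddAbove_benchmarkValues {n : ℕ} (ρ ξ : Fin n → ℝ) : BddAbove (benchmarkValues ρ ξ) := by
  refine ⟨∑ _θ : Equiv.Perm (Fin n), ∑ _σ : Fin n → Bool, ∑ i, |ξ i|, ?_⟩
  rintro _ ⟨φ, -, rfl⟩
  refine Finset.sum_le_sum fun θ _ => Finset.sum_le_sum fun σ _ => ?_
  have hp : ∀ t, 0 ≤ (if σ t = true then φ.hireProb t θ σ else 1 - φ.hireProb t θ σ) ∧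
      (if σ t = true then φ.hireProb t θ σ else 1 - φ.hireProb t θ σ) ≤ 1 := by
    intro t
    have h1 := φ.nonneg t θ σ
    have h2 := φ.le_one t θ σ
    split_ifs <;> constructor <;> linarith
  have hfac : (1 : ℝ) ≤ n.factorial := by exact_mod_cast n.factorial_pos
  have h0 : 0 ≤ φ.law θ σ :=
    mul_nonneg (by positivity) (Finset.prod_nonneg fun t _ => (hp t).1)
  have h1 : φ.law θ σ ≤ 1 :=
    mul_le_one₀ ((div_le_one (by linarith)).2 hfac) (Finset.prod_nonneg fun t _ => (hp t).1)
      (Finset.prod_le_one (fun t _ => (hp t).1) fun t _ => (hp t).2)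
  have h2 : obedientPayoff ξ θ σ ≤ ∑ i, |ξ i| := by
    rw [← Equiv.sum_comp θ]
    refine Finset.sum_le_sum fun t _ => ?_
    split_ifs
    · exact le_abs_self _
    · exact abs_nonneg _
  have h3 : 0 ≤ ∑ i, |ξ i| := Finset.sum_nonneg fun i _ => abs_nonneg _
  nlinarith

/-- The benchmark optimum is the least upper bound of the values of persuasive mechanisms. -/
theorem isLUB_benchmarkOpt {n : ℕ} (ρ ξ : Fin n → ℝ) (hρ : ∀ i, 0 ≤ ρ i) :
    IsLUB (benchmarkValues ρ ξ) (benchmarkOpt ρ ξ) :=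
  isLUB_csSup ⟨_, alwaysHire n, persuasive_alwaysHire ρ hρ, rfl⟩ (bddAbove_benchmarkValues ρ ξ)

end OnlinePersuasion

/-! For a set `C` of remaining candidates, let q be the law of the candidate that the Pareto
procedure returns, and let V(C) and r(C) be its expected sender and receiver utility. By the choice
of the frontier segment, V(C) is the most that the sender can get from any lottery on `C` that gives
the receiver at least the mean of `C` (`sum_le_returned`).

Upper bound on the optimum. Without disclosure the receiver may ignore the signals and hire the
first candidate, so a persuasive mechanism gives her at least the overall mean. Its hiring
probabilities, completed to a lottery, are then feasible, and the optimum is at most V of the full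
set.

Lower bound for the mechanism. In the round with remaining set `C` of size k+1, candidate i arrives
with probability 1/(k+1) and is hired with probability q_i. Multiplying expectations by factorials
gives the recursion `value`. The claim k! V(C) ≤ 3 `value` follows by induction from Σ (1 - q_i) V(C
\ i) ≥ (|C| - 3) V(C) (`sum_returned_erase_ge`). Here the at most two candidates that can be
returned cost at most two terms. Removing any other candidate costs at most its share of the total
shortfall of receiver utilities below r(C), and these shares sum to at most one
(`returned_erase_ge`). The factor 1/3 thus holds for every n.

Persuasiveness. All bounds rest on r(C) ≥ mean of `C`. After a HIRE the later signals carry no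
information, so rejecting yields at most the mean of the remaining candidates, on average at most
r(C). After a NOT the current candidate is, on average, no better than the mean of the others, which
obedience secures. Backward induction extends this to all strategies (`continuation_le_value`). -/

namespace OnlinePersuasion

variable {n : ℕ}

/-! ### Conditional expectations along the process -/

/-- Probability of the signal `σ t` in round `t`. -/
noncomputable def DirectMechanism.signalProb (φ : DirectMechanism n) (t : Fin n)
    (θ : Equiv.Perm (Fin n)) (σ : Fin n → Bool) : ℝ :=
  if σ t = true then φ.hireProb t θ σ else 1 - φ.hireProb t θ σ

/-- The histories agree in all rounds before `t`. -/
def AgreeBefore (t : ℕ) (θ θ' : Equiv.Perm (Fin n)) (σ σ' : Fin n → Bool) : Prop :=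
  ∀ s : Fin n, (s : ℕ) < t → θ s = θ' s ∧ σ s = σ' s

/-- The candidates that have not arrived in the first `t` rounds. -/
def remainingFrom (t : ℕ) (θ : Equiv.Perm (Fin n)) : Finset (Fin n) :=
  Finset.univ.filter (fun i => ∀ s : Fin n, (s : ℕ) < t → θ s ≠ i)

/-- Change the order `θ` so that candidate `i` arrives in round `t`. -/
def arrive (θ : Equiv.Perm (Fin n)) (t i : Fin n) : Equiv.Perm (Fin n) :=
  θ * Equiv.swap t (θ⁻¹ i)

/-- Sum of `f` over all continuations of a history of `t` rounds, weighted with the probabilities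
of the signals from round `t` on. -/
noncomputable def DirectMechanism.continuation (φ : DirectMechanism n) (t : ℕ)
    (θ₀ : Equiv.Perm (Fin n)) (σ₀ : Fin n → Bool)
    (f : Equiv.Perm (Fin n) → (Fin n → Bool) → ℝ) : ℝ :=
  open Classical in
  ∑ θ, ∑ σ, if AgreeBefore t θ₀ θ σ₀ σ then
    (∏ s ∈ Finset.univ.filter (fun s : Fin n => t ≤ s), φ.signalProb s θ σ) * f θ σ else 0

/-- Like `continuation`, with the signal of round `t` already known. -/
noncomputable def DirectMechanism.informed (φ : DirectMechanism n) (t : Fin n)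
    (θ₀ : Equiv.Perm (Fin n)) (σ₀ : Fin n → Bool)
    (f : Equiv.Perm (Fin n) → (Fin n → Bool) → ℝ) : ℝ :=
  open Classical in
  ∑ θ, ∑ σ, if SameInfo true t θ₀ θ σ₀ σ then
    (∏ s ∈ Finset.univ.filter (fun s : Fin n => (t : ℕ) ≤ s), φ.signalProb s θ σ) * f θ σ else 0

/-! ### Arrivals and the sets of remaining candidates -/

theorem mem_remainingFrom {t : ℕ} {θ : Equiv.Perm (Fin n)} {i : Fin n} :
    i ∈ remainingFrom t θ ↔ ∀ s : Fin n, (s : ℕ) < t → θ s ≠ i := by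
  simp [remainingFrom]

theorem remaining_eq_remainingFrom (t : Fin n) (θ : Equiv.Perm (Fin n)) :
    remaining t θ = remainingFrom t θ := rfl

theorem arrive_self (θ : Equiv.Perm (Fin n)) (t i : Fin n) : arrive θ t i t = i := by
  simp [arrive]

theorem arrive_of_lt {θ : Equiv.Perm (Fin n)} {t i s : Fin n} (hi : i ∈ remainingFrom t θ)
    (hs : s < t) : arrive θ t i s = θ s := by
  have h : s ≠ θ⁻¹ i := fun h => mem_remainingFrom.1 hi s hs (by simp [h])
  rw [arrive, Equiv.Perm.mul_apply, Equiv.swap_apply_of_ne_of_ne hs.ne h]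

theorem remainingFrom_congr {t : ℕ} {θ θ' : Equiv.Perm (Fin n)}
    (h : ∀ s : Fin n, (s : ℕ) < t → θ s = θ' s) : remainingFrom t θ = remainingFrom t θ' := by
  ext i
  simp only [mem_remainingFrom]
  exact forall_congr' fun s => forall_congr' fun hs => by rw [h s hs]

theorem remainingFrom_arrive {θ : Equiv.Perm (Fin n)} {t i : Fin n}
    (hi : i ∈ remainingFrom t θ) :
    remainingFrom (t + 1) (arrive θ t i) = (remainingFrom t θ).erase i := by
  ext j
  simp only [mem_remainingFrom, Finset.mem_erase]
  constructor
  · intro h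
    refine ⟨fun hj => h t (Nat.lt_succ_self _) (by rw [arrive_self, hj]), fun s hs => ?_⟩
    rw [← arrive_of_lt hi hs]
    exact h s (Nat.lt_succ_of_lt hs)
  · rintro ⟨hj, h⟩ s hs
    rcases Nat.lt_succ_iff_lt_or_eq.1 hs with hlt | heq
    · rw [arrive_of_lt hi hlt]; exact h s hlt
    · rw [Fin.ext heq, arrive_self]; exact hj.symm

theorem remainingFrom_zero (θ : Equiv.Perm (Fin n)) : remainingFrom 0 θ = Finset.univ := by
  simp [remainingFrom]

theorem card_remainingFrom (t : ℕ) (θ : Equiv.Perm (Fin n)) :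
    (remainingFrom t θ).card = n - t := by
  have h : remainingFrom t θ = (Finset.univ.filter fun s : Fin n => ¬ (s : ℕ) < t).map
      θ.toEmbedding := by
    ext i
    simp only [mem_remainingFrom, Finset.mem_map, Finset.mem_filter, Finset.mem_univ, true_and,
      Equiv.coe_toEmbedding]
    constructor
    · intro h
      exact ⟨θ⁻¹ i, fun hlt => h _ hlt (by simp), by simp⟩
    · rintro ⟨s, hs, rfl⟩ s' hs' h
      exact hs (θ.injective h ▸ hs')
  rw [h, Finset.card_map, Finset.filter_not, Finset.card_sdiff_of_subset (Finset.filter_subset _ _),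
    Finset.card_univ, Fintype.card_fin, Fin.card_filter_val_lt]
  omega

/-! ### Signal probabilities and one-round recursions -/

theorem DirectMechanism.signalProb_congr (φ : DirectMechanism n) {t : Fin n}
    {θ θ' : Equiv.Perm (Fin n)} {σ σ' : Fin n → Bool} (hθ : ∀ s, s ≤ t → θ s = θ' s)
    (hσ : ∀ s, s ≤ t → σ s = σ' s) : φ.signalProb t θ σ = φ.signalProb t θ' σ' := by
  unfold DirectMechanism.signalProb
  rw [hσ t le_rfl, φ.causal t θ θ' σ σ' hθ fun s hs => hσ s hs.le]

theorem DirectMechanism.signalProb_nonneg (φ : DirectMechanism n) (t : Fin n)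
    (θ : Equiv.Perm (Fin n)) (σ : Fin n → Bool) : 0 ≤ φ.signalProb t θ σ := by
  unfold DirectMechanism.signalProb
  split_ifs
  · exact φ.nonneg _ _ _
  · linarith [φ.le_one t θ σ]

theorem DirectMechanism.law_eq (φ : DirectMechanism n) (θ : Equiv.Perm (Fin n))
    (σ : Fin n → Bool) :
    φ.law θ σ = 1 / (n.factorial : ℝ) * ∏ t, φ.signalProb t θ σ := rfl

theorem DirectMechanism.law_nonneg (φ : DirectMechanism n) (θ : Equiv.Perm (Fin n))
    (σ : Fin n → Bool) : 0 ≤ φ.law θ σ :=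
  mul_nonneg (by positivity) (Finset.prod_nonneg fun t _ => φ.signalProb_nonneg t θ σ)

theorem DirectMechanism.continuation_congr (φ : DirectMechanism n) {t : ℕ}
    {θ₀ : Equiv.Perm (Fin n)} {σ₀ : Fin n → Bool}
    {f g : Equiv.Perm (Fin n) → (Fin n → Bool) → ℝ}
    (h : ∀ θ σ, AgreeBefore t θ₀ θ σ₀ σ → f θ σ = g θ σ) :
    φ.continuation t θ₀ σ₀ f = φ.continuation t θ₀ σ₀ g := by
  unfold DirectMechanism.continuation
  refine Finset.sum_congr rfl fun θ _ => Finset.sum_congr rfl fun σ _ => ?_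
  split_ifs with hag
  · rw [h θ σ hag]
  · rfl

/-- Splits the orders by the candidate i of round `t`, which the receiver does not see. Sums are not
normalized: each arrival has weight one, which is why factorials appear instead of conditional
probabilities. -/
theorem DirectMechanism.informed_eq (φ : DirectMechanism n) (t : Fin n)
    (θ₀ : Equiv.Perm (Fin n)) (σ₀ : Fin n → Bool)
    (f : Equiv.Perm (Fin n) → (Fin n → Bool) → ℝ) :
    φ.informed t θ₀ σ₀ f = ∑ i ∈ remainingFrom t θ₀,
      φ.signalProb t (arrive θ₀ t i) σ₀ * φ.continuation (t + 1) (arrive θ₀ t i) σ₀ f := by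
  classical
  unfold DirectMechanism.informed DirectMechanism.continuation
  simp only [Finset.mul_sum]
  rw [Finset.sum_comm (s := remainingFrom t θ₀)]
  refine Finset.sum_congr rfl fun θ _ => ?_
  rw [Finset.sum_comm (s := remainingFrom t θ₀)]
  refine Finset.sum_congr rfl fun σ _ => ?_
  have agree : ∀ i ∈ remainingFrom t θ₀, AgreeBefore (t + 1) (arrive θ₀ t i) θ σ₀ σ →
      SameInfo true t θ₀ θ σ₀ σ ∧ i = θ t := by
    intro i hi h
    refine ⟨⟨fun s hs => (h s (Nat.lt_succ_of_le hs)).2, fun _ s hs => ?_⟩, ?_⟩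
    · rw [← (h s (Nat.lt_succ_of_lt hs)).1, arrive_of_lt hi hs]
    · rw [← (h t (Nat.lt_succ_self _)).1, arrive_self]
  split_ifs with hinfo
  · have hmem : θ t ∈ remainingFrom t θ₀ := by
      rw [remainingFrom_congr (hinfo.2 rfl)]
      exact mem_remaining t θ
    have hag : ∀ s, s ≤ t → arrive θ₀ t (θ t) s = θ s := by
      intro s hs
      rcases hs.lt_or_eq with hlt | rfl
      · rw [arrive_of_lt hmem hlt]; exact hinfo.2 rfl s hlt
      · rw [arrive_self]
    rw [Finset.sum_eq_single_of_mem _ hmem]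
    · have hpos : AgreeBefore (t + 1) (arrive θ₀ t (θ t)) θ σ₀ σ := fun s hs =>
        ⟨hag s (Nat.le_of_lt_succ hs), hinfo.1 s (Nat.le_of_lt_succ hs)⟩
      rw [if_pos hpos, φ.signalProb_congr hag hinfo.1, ← mul_assoc]
      congr 1
      rw [← Finset.prod_insert (s := Finset.univ.filter fun s : Fin n => (t : ℕ) + 1 ≤ s)
        (f := fun s => φ.signalProb s θ σ) (by simp)]
      refine Finset.prod_congr ?_ fun _ _ => rfl
      ext s
      simp only [Finset.mem_filter, Finset.mem_univ, true_and, Finset.mem_insert, Fin.ext_iff]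
      omega
    · intro i hi hne
      rw [if_neg fun h => hne (agree i hi h).2, mul_zero]
  · symm
    refine Finset.sum_eq_zero fun i hi => ?_
    rw [if_neg fun h => hinfo (agree i hi h).1, mul_zero]

theorem DirectMechanism.continuation_eq_informed (φ : DirectMechanism n) (t : Fin n)
    (θ₀ : Equiv.Perm (Fin n)) (σ₀ : Fin n → Bool)
    (f : Equiv.Perm (Fin n) → (Fin n → Bool) → ℝ) :
    φ.continuation t θ₀ σ₀ f = φ.informed t θ₀ (Function.update σ₀ t true) f +
      φ.informed t θ₀ (Function.update σ₀ t false) f := by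
  classical
  unfold DirectMechanism.informed DirectMechanism.continuation
  rw [← Finset.sum_add_distrib]
  refine Finset.sum_congr rfl fun θ _ => ?_
  rw [← Finset.sum_add_distrib]
  refine Finset.sum_congr rfl fun σ _ => ?_
  have iff : ∀ b, SameInfo true t θ₀ θ (Function.update σ₀ t b) σ ↔
      AgreeBefore t θ₀ θ σ₀ σ ∧ σ t = b := by
    intro b
    constructor
    · intro h
      refine ⟨fun s hs => ⟨h.2 rfl s hs, ?_⟩, ?_⟩
      · rw [← h.1 s (le_of_lt hs), Function.update_of_ne (Fin.ne_of_lt hs)]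
      · rw [← h.1 t le_rfl, Function.update_self]
    · rintro ⟨h, rfl⟩
      refine ⟨fun s hs => ?_, fun _ s hs => (h s hs).1⟩
      rcases hs.lt_or_eq with hlt | rfl
      · rw [Function.update_of_ne hlt.ne]; exact (h s hlt).2
      · rw [Function.update_self]
  simp only [iff]
  cases σ t <;> simp

theorem DirectMechanism.continuation_of_le (φ : DirectMechanism n) {t : ℕ} (ht : n ≤ t)
    (θ₀ : Equiv.Perm (Fin n)) (σ₀ : Fin n → Bool)
    (f : Equiv.Perm (Fin n) → (Fin n → Bool) → ℝ) :
    φ.continuation t θ₀ σ₀ f = f θ₀ σ₀ := by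
  classical
  have iff : ∀ θ σ, AgreeBefore t θ₀ θ σ₀ σ ↔ θ = θ₀ ∧ σ = σ₀ := by
    intro θ σ
    constructor
    · intro h
      exact ⟨Equiv.ext fun s => (h s (s.2.trans_le ht)).1.symm,
        funext fun s => (h s (s.2.trans_le ht)).2.symm⟩
    · rintro ⟨rfl, rfl⟩ s _
      exact ⟨rfl, rfl⟩
  have hempty : (Finset.univ.filter fun s : Fin n => t ≤ s) = ∅ := by
    ext s; simp; omega
  unfold DirectMechanism.continuation
  simp [iff, hempty, ite_and]

theorem DirectMechanism.signalProb_add (φ : DirectMechanism n) (t : Fin n)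
    (θ : Equiv.Perm (Fin n)) (σ : Fin n → Bool) :
    φ.signalProb t θ (Function.update σ t true) + φ.signalProb t θ (Function.update σ t false)
      = 1 := by
  have h : ∀ b, φ.hireProb t θ (Function.update σ t b) = φ.hireProb t θ σ := fun b =>
    φ.causal _ _ _ _ _ (fun _ _ => rfl) fun s hs => Function.update_of_ne hs.ne _ _
  simp [DirectMechanism.signalProb, h]

theorem DirectMechanism.continuation_const (φ : DirectMechanism n) (c : ℝ) (k : ℕ) :
    ∀ (t : ℕ) (θ₀ : Equiv.Perm (Fin n)) (σ₀ : Fin n → Bool), n = t + k →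
      φ.continuation t θ₀ σ₀ (fun _ _ => c) = k.factorial * c := by
  induction k with
  | zero =>
    intro t θ₀ σ₀ h
    rw [φ.continuation_of_le (by omega)]
    simp
  | succ k ih =>
    intro t θ₀ σ₀ h
    have e := φ.continuation_eq_informed ⟨t, by omega⟩ θ₀ σ₀ (fun _ _ => c)
    simp only [φ.informed_eq] at e
    rw [e, ← Finset.sum_add_distrib,
      Finset.sum_congr rfl (g := fun _ => (k.factorial : ℝ) * c), Finset.sum_const,
      card_remainingFrom, nsmul_eq_mul, show n - t = k + 1 by omega, Nat.factorial_succ]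
    · push_cast; ring
    · intro i _
      rw [ih (t + 1) _ _ (by omega), ih (t + 1) _ _ (by omega), ← add_mul, φ.signalProb_add,
        one_mul]

theorem DirectMechanism.continuation_zero (φ : DirectMechanism n) (θ₀ : Equiv.Perm (Fin n))
    (σ₀ : Fin n → Bool) (f : Equiv.Perm (Fin n) → (Fin n → Bool) → ℝ) :
    ∑ θ, ∑ σ, φ.law θ σ * f θ σ = 1 / (n.factorial : ℝ) * φ.continuation 0 θ₀ σ₀ f := by
  classical
  unfold DirectMechanism.continuation
  simp only [Finset.mul_sum]
  refine Finset.sum_congr rfl fun θ _ => Finset.sum_congr rfl fun σ _ => ?_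
  have hpos : AgreeBefore 0 θ₀ θ σ₀ σ := fun s hs => absurd hs (Nat.not_lt_zero _)
  rw [if_pos hpos, φ.law_eq, mul_assoc]
  simp

/-- With disclosure the past is fully known, so its probability factors out. It is nonnegative and
the same for all strategies; incentives need only be compared on `informed`, and information of
probability zero causes no trouble. -/
theorem utilityAt_eq_informed (ρ : Fin n → ℝ) (φ : DirectMechanism n)
    (d : ReceiverStrategy n true) (t : Fin n) (θ₀ : Equiv.Perm (Fin n)) (σ₀ : Fin n → Bool) :
    utilityAt ρ φ d t θ₀ σ₀ = 1 / (n.factorial : ℝ) *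
      (∏ s ∈ Finset.univ.filter (fun s : Fin n => s < t), φ.signalProb s θ₀ σ₀) *
      φ.informed t θ₀ σ₀ (payoffFrom ρ d t) := by
  classical
  unfold utilityAt DirectMechanism.informed
  simp only [Finset.mul_sum]
  refine Finset.sum_congr rfl fun θ _ => Finset.sum_congr rfl fun σ _ => ?_
  split_ifs with h
  · rw [φ.law_eq, ← Finset.prod_filter_mul_prod_filter_not Finset.univ (fun s => s < t),
      Finset.prod_congr rfl (g := fun s => φ.signalProb s θ₀ σ₀)]
    · have : (Finset.univ.filter fun s : Fin n => ¬ s < t) =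
          Finset.univ.filter fun s : Fin n => (t : ℕ) ≤ s := by
        ext s; simp
      rw [this]; ring
    · intro s hs
      have hs : s < t := by simpa using hs
      exact (φ.signalProb_congr (fun r hr => h.2 rfl r (lt_of_le_of_lt hr hs))
        fun r hr => h.1 r (le_trans hr hs.le)).symm
  · simp

/-! ### The lottery of the Pareto procedure -/

theorem card_mul_receiverMean (ρ : Fin n → ℝ) (C : Finset (Fin n)) :
    (C.card : ℝ) * receiverMean ρ C = ∑ i ∈ C, ρ i := by
  rcases C.eq_empty_or_nonempty with rfl | hC
  · simp
  · rw [receiverMean, mul_div_cancel₀]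
    exact_mod_cast hC.card_pos.ne'

theorem receiverMean_nonneg {ρ : Fin n → ℝ} (hρ : ∀ i, 0 ≤ ρ i) (C : Finset (Fin n)) :
    0 ≤ receiverMean ρ C :=
  div_nonneg (Finset.sum_nonneg fun i _ => hρ i) (Nat.cast_nonneg _)

theorem mul_receiverMean_erase (ρ : Fin n → ℝ) {C : Finset (Fin n)} {k : ℕ} (hk : C.card = k + 1)
    {i : Fin n} (hi : i ∈ C) :
    (k : ℝ) * receiverMean ρ (C.erase i) = (k + 1) * receiverMean ρ C - ρ i := by
  have h1 := card_mul_receiverMean ρ (C.erase i)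
  have h2 := card_mul_receiverMean ρ C
  rw [Finset.card_erase_of_mem hi, hk, Nat.add_sub_cancel] at h1
  rw [hk] at h2
  push_cast at h2
  rw [h1, h2, ← Finset.add_sum_erase C ρ hi]
  ring

theorem sum_receiverMean_erase_le {ρ : Fin n → ℝ} (hρ : ∀ i, 0 ≤ ρ i) {C : Finset (Fin n)} {k : ℕ}
    (hk : C.card = k + 1) :
    ∑ i ∈ C, receiverMean ρ (C.erase i) ≤ (k + 1) * receiverMean ρ C := by
  have h : (k : ℝ) * ∑ i ∈ C, receiverMean ρ (C.erase i) = k * ((k + 1) * receiverMean ρ C) := by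
    rw [Finset.mul_sum, Finset.sum_congr rfl fun i hi => mul_receiverMean_erase ρ hk hi,
      Finset.sum_sub_distrib, ← card_mul_receiverMean ρ C, Finset.sum_const, nsmul_eq_mul, hk]
    push_cast
    ring
  -- Equality holds for positive `k`. For a single candidate the mean of the empty set is 0 by
  -- default, and nonnegativity is needed.
  rcases k.eq_zero_or_pos with rfl | hpos
  · obtain ⟨i, rfl⟩ := Finset.card_eq_one.1 hk
    simpa [receiverMean] using hρ i
  · exact (mul_left_cancel₀ (by positivity) h).le

namespace ParetoProcedure

variable {ρ ξ : Fin n → ℝ} (P : ParetoProcedure ρ ξ) {C : Finset (Fin n)}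

/-! ### The lottery and its optimality -/

theorem a_mem (hC : C.Nonempty) : P.a C ∈ C := by
  obtain ⟨c, hc, -, ⟨-, h, -⟩ | ⟨-, h, -⟩⟩ := P.isParetoPair C hC
  · rwa [h]
  · exact h

theorem b_mem (hC : C.Nonempty) : P.b C ∈ C := by
  obtain ⟨c, hc, -, ⟨-, -, h⟩ | ⟨-, -, h, -⟩⟩ := P.isParetoPair C hC
  · rwa [h]
  · exact h

/-- Expected utility `u` of the candidate returned on input `C`. -/
noncomputable def returned (u : Fin n → ℝ) (C : Finset (Fin n)) : ℝ :=
  ∑ i ∈ C, P.returnProb C i * u i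

theorem returned_eq (hC : C.Nonempty) (u : Fin n → ℝ) :
    P.returned u C = P.alpha C * u (P.a C) + (1 - P.alpha C) * u (P.b C) := by
  unfold returned returnProb
  simp only [add_mul, ite_mul, zero_mul, Finset.sum_add_distrib, Finset.sum_ite_eq']
  rw [if_pos (P.a_mem hC), if_pos (P.b_mem hC)]

theorem sum_returnProb (hC : C.Nonempty) : ∑ i ∈ C, P.returnProb C i = 1 := by
  have := P.returned_eq hC fun _ => 1
  simpa [returned] using this

theorem returned_nonneg (hC : C.Nonempty) {u : Fin n → ℝ} (hu : ∀ i, 0 ≤ u i) :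
    0 ≤ P.returned u C :=
  Finset.sum_nonneg fun i _ => mul_nonneg (P.returnProb_mem C hC i).1 (hu i)

/-- The weight `alpha` places the lottery exactly at the mean, except when `a = b = c`, or when a
horizontal segment makes it return `b`; there the receiver can get more. -/
theorem mean_le_returned (hC : C.Nonempty) : receiverMean ρ C ≤ P.returned ρ C := by
  rw [P.returned_eq hC]
  obtain ⟨h0, h1⟩ := P.alpha_mem C hC
  obtain ⟨c, -, -, ⟨h, ha, hb⟩ | ⟨-, -, -, ha, hb, -⟩⟩ := P.isParetoPair C hC
  · rw [ha, hb]; linarith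
  · unfold alpha
    split_ifs with h1 h2
    · rw [h1]; linarith
    · linarith
    · have h3 : ρ (P.a C) - ρ (P.b C) ≠ 0 := sub_ne_zero.2 h1
      refine le_of_eq ?_
      field_simp
      ring

theorem returned_eq_mean (h : ¬ (ρ (P.a C) ≠ ρ (P.b C) ∧ ξ (P.a C) = ξ (P.b C)))
    (hC : C.Nonempty) (ha : ρ (P.a C) ≤ receiverMean ρ C) (hb : receiverMean ρ C ≤ ρ (P.b C)) :
    P.returned ρ C = receiverMean ρ C := by
  rw [P.returned_eq hC]
  unfold alpha
  split_ifs with h1 h2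
  · rw [← h1] at hb; linarith
  · exact absurd ⟨h1, h2⟩ h
  · have h3 : ρ (P.a C) - ρ (P.b C) ≠ 0 := sub_ne_zero.2 h1
    field_simp
    ring

/-- The key optimality property: a feasible lottery with a larger sender value could be perturbed
inside the hull to a point that strictly beats a point of the frontier segment in both coordinates.
-/
theorem sum_le_returned (hξ : ∀ i, 0 ≤ ξ i) (hC : C.Nonempty) {y : Fin n → ℝ}
    (hy : ∀ i ∈ C, 0 ≤ y i) (hy1 : ∑ i ∈ C, y i = 1)
    (hyρ : receiverMean ρ C ≤ ∑ i ∈ C, y i * ρ i) :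
    ∑ i ∈ C, y i * ξ i ≤ P.returned ξ C := by
  have lemax : ∀ c, (∀ i ∈ C, ξ i ≤ ξ c) → ∑ i ∈ C, y i * ξ i ≤ ξ c := by
    intro c hc
    calc ∑ i ∈ C, y i * ξ i ≤ ∑ i ∈ C, y i * ξ c :=
          Finset.sum_le_sum fun i hi => mul_le_mul_of_nonneg_left (hc i hi) (hy i hi)
      _ = ξ c := by rw [← Finset.sum_mul, hy1, one_mul]
  have memhull : ∀ i ∈ C, (ρ i, ξ i) ∈ valuationHull ρ ξ C := fun i hi =>
    subset_convexHull ℝ _ ⟨i, by simpa using hi, rfl⟩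
  have hconv : Convex ℝ (valuationHull ρ ξ C) := convex_convexHull ℝ _
  obtain ⟨hα0, hα1⟩ := P.alpha_mem C hC
  obtain ⟨c, hcC, hc, ⟨-, ha, hb⟩ | ⟨hcμ, haC, hbC, ha, hb, hseg⟩⟩ := P.isParetoPair C hC
  · rw [P.returned_eq hC, ha, hb]
    have := lemax c hc
    linarith
  by_cases hflat : ρ (P.a C) ≠ ρ (P.b C) ∧ ξ (P.a C) = ξ (P.b C)
  · rw [P.returned_eq hC, hflat.2]
    -- On a horizontal segment `b` must be sender-optimal. Otherwise `c`, or a mixture of `b` with a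
    -- little of `c`, strictly dominates `a`.
    have hcb : ξ c ≤ ξ (P.b C) := by
      by_contra! hlt
      have hfront := (hseg (left_mem_segment ℝ _ _)).2
      have hab : ρ (P.a C) < ρ (P.b C) := lt_of_le_of_ne (ha.trans hb) hflat.1
      rcases lt_or_ge (ρ (P.a C)) (ρ c) with h | h
      · exact hfront _ (memhull c hcC) ⟨h, by rw [hflat.2]; exact hlt⟩
      · have hpos : 0 < ρ (P.b C) - ρ c := by linarith
        -- With this weight on `c`, the receiver coordinate of the mixture is the midpoint of those
        -- of `a` and `b`.
        set ε := (ρ (P.b C) - ρ (P.a C)) / (2 * (ρ (P.b C) - ρ c)) with hε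
        have hε0 : 0 < ε := div_pos (by linarith) (by linarith)
        have hε1 : ε ≤ 1 := by rw [hε, div_le_one (by linarith)]; linarith
        have hεmul : ε * (ρ (P.b C) - ρ c) = (ρ (P.b C) - ρ (P.a C)) / 2 := by
          rw [hε]; field_simp
        refine hfront _ (hconv (memhull c hcC) (memhull _ hbC) hε0.le (sub_nonneg.2 hε1)
          (by ring)) ⟨?_, ?_⟩
        · simp only [Prod.fst_add, Prod.smul_fst, smul_eq_mul]
          nlinarith
        · simp only [Prod.snd_add, Prod.smul_snd, smul_eq_mul]
          rw [hflat.2]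
          nlinarith
    have := lemax c hc
    linarith
  · have hr := P.returned_eq_mean hflat hC ha hb
    by_contra! hlt
    have hV := P.returned_nonneg hC hξ
    -- As `c` is strictly below the mean, some candidate is strictly above it; mixing it in makes
    -- the receiver's gain strict.
    obtain ⟨j, hj, hjμ⟩ : ∃ j ∈ C, receiverMean ρ C < ρ j := by
      by_contra! hcon
      have h1 : ∑ i ∈ C, ρ i < ∑ _i ∈ C, receiverMean ρ C :=
        Finset.sum_lt_sum hcon ⟨c, hcC, hcμ⟩
      rw [Finset.sum_const, nsmul_eq_mul, card_mul_receiverMean] at h1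
      exact lt_irrefl _ h1
    have hp : (P.returned ρ C, P.returned ξ C) ∈
        segment ℝ (ρ (P.a C), ξ (P.a C)) (ρ (P.b C), ξ (P.b C)) :=
      ⟨P.alpha C, 1 - P.alpha C, hα0, sub_nonneg.2 hα1, by ring, by
        rw [P.returned_eq hC, P.returned_eq hC]; simp⟩
    have hq : (∑ i ∈ C, y i * ρ i, ∑ i ∈ C, y i * ξ i) ∈ valuationHull ρ ξ C := by
      have h := hconv.sum_mem hy hy1 memhull
      convert h using 1
      ext <;> simp [Prod.fst_sum, Prod.snd_sum]
    set Y := ∑ i ∈ C, y i * ξ i with hY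
    set V := P.returned ξ C with hVdef
    have hYpos : 0 < Y := by linarith
    -- The weight on `j`: the sender loses at most `ε * Y`, half of the gap between `Y` and `V`.
    set ε := (Y - V) / (2 * Y) with hε
    have hε0 : 0 < ε := div_pos (by linarith) (by linarith)
    have hε1 : ε ≤ 1 := by rw [hε, div_le_one (by linarith)]; linarith
    have hεmul : ε * Y = (Y - V) / 2 := by rw [hε]; field_simp
    refine (hseg hp).2 _ (hconv (memhull j hj) hq hε0.le (sub_nonneg.2 hε1) (by ring)) ⟨?_, ?_⟩
    · simp only [Prod.fst_add, Prod.smul_fst, smul_eq_mul]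
      rw [hr]
      nlinarith
    · simp only [Prod.snd_add, Prod.smul_snd, smul_eq_mul]
      nlinarith [mul_nonneg hε0.le (hξ j)]

/-! ### The sender's loss when a candidate leaves -/

theorem returnProb_eq_zero {i : Fin n} (ha : i ≠ P.a C) (hb : i ≠ P.b C) :
    P.returnProb C i = 0 := by
  simp [returnProb, ha, hb]

/-- Removing a candidate that is never returned costs at most its share of the total deficit with
respect to the receiver's expected utility. -/
theorem returned_erase_ge (hξ : ∀ i, 0 ≤ ξ i) {i : Fin n} (hi : i ∈ C)
    (hne : (C.erase i).Nonempty) (hq : P.returnProb C i = 0) :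
    (1 - max (P.returned ρ C - ρ i) 0 / ∑ j ∈ C, max (P.returned ρ C - ρ j) 0) * P.returned ξ C ≤
      P.returned ξ (C.erase i) := by
  have hC : C.Nonempty := ⟨i, hi⟩
  set r := P.returned ρ C with hr
  set D := ∑ j ∈ C, max (r - ρ j) 0 with hD
  have hrμ : receiverMean ρ C ≤ r := P.mean_le_returned hC
  have hV := P.returned_nonneg hC hξ
  have hD0 : 0 ≤ D := Finset.sum_nonneg fun j _ => le_max_right _ _
  have hq0 : ∀ j, 0 ≤ P.returnProb C j := fun j => (P.returnProb_mem C hC j).1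
  have sumErase : ∀ u : Fin n → ℝ, ∑ j ∈ C.erase i, P.returnProb C j * u j = P.returned u C := by
    intro u
    rw [returned, ← Finset.add_sum_erase C _ hi, hq]
    simp
  have sumErase1 : ∑ j ∈ C.erase i, P.returnProb C j = 1 := by
    rw [← P.sum_returnProb hC, ← Finset.add_sum_erase C _ hi, hq, zero_add]
  -- If the new mean is at most `r`, the old lottery stays feasible and nothing is lost.
  rcases le_or_gt (receiverMean ρ (C.erase i)) r with hle | hgt
  · have h1 := P.sum_le_returned hξ hne (fun j _ => hq0 j) sumErase1 (by rw [sumErase]; exact hle)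
    rw [sumErase] at h1
    have h2 : 0 ≤ max (r - ρ i) 0 / D := div_nonneg (le_max_right _ _) hD0
    nlinarith
  -- Otherwise feasibility is repaired by shifting some weight of the old lottery to the receiver's
  -- favorite `z`.
  · obtain ⟨z, hz, hzmax⟩ := (C.erase i).exists_max_image ρ hne
    set m' : ℝ := ((C.erase i).card : ℝ) with hm'
    have hm'pos : 0 < m' := by rw [hm']; exact_mod_cast hne.card_pos
    have hzmean : receiverMean ρ (C.erase i) ≤ ρ z := by
      rw [receiverMean, div_le_iff₀ hm'pos, mul_comm, ← nsmul_eq_mul]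
      exact Finset.sum_le_card_nsmul _ _ _ hzmax
    have hsumC : ∑ j ∈ C, (ρ j - r) ≤ 0 := by
      have hc0 : (0 : ℝ) ≤ C.card := Nat.cast_nonneg _
      rw [Finset.sum_sub_distrib, ← card_mul_receiverMean, Finset.sum_const, nsmul_eq_mul]
      nlinarith
    have hsumE : ∑ j ∈ C.erase i, (ρ j - r) = m' * (receiverMean ρ (C.erase i) - r) := by
      rw [Finset.sum_sub_distrib, ← card_mul_receiverMean, Finset.sum_const, nsmul_eq_mul]
      ring
    have hsplit := Finset.add_sum_erase C (fun j => ρ j - r) hi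
    have hEpos : 0 < m' * (receiverMean ρ (C.erase i) - r) := mul_pos hm'pos (by linarith)
    have hdi : 0 < r - ρ i := by
      linarith
    have hmaxi : max (r - ρ i) 0 = r - ρ i := max_eq_left hdi.le
    have hDpos : 0 < D := by
      have := Finset.single_le_sum (f := fun j => max (r - ρ j) 0)
        (fun j _ => le_max_right _ _) hi
      simp only [hmaxi] at this
      linarith
    -- the surplus of the remaining candidates is at most that of the best one times their number
    have hDplus : ∑ j ∈ C.erase i, (ρ j - r) + (D - (r - ρ i)) ≤ m' * (ρ z - r) := by
      have h1 : D - (r - ρ i) = ∑ j ∈ C.erase i, max (r - ρ j) 0 := by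
        rw [hD, ← Finset.add_sum_erase C _ hi, hmaxi]; ring
      rw [h1, ← Finset.sum_add_distrib, hm', ← nsmul_eq_mul]
      refine Finset.sum_le_card_nsmul _ _ _ fun j hj => ?_
      have := hzmax j hj
      rcases le_total (r - ρ j) 0 with h | h
      · rw [max_eq_right h]; linarith
      · rw [max_eq_left h]; linarith
    -- This share suffices: with E the sum of `ρ j - r` over the rest, `E ≤ r - ρ i`, and `hDplus`
    -- gives `s * (m' * (ρ z - r)) ≥ s * E + (1 - s) * (r - ρ i) ≥ E`.
    set s := (r - ρ i) / D with hs
    have hsD : s * D = r - ρ i := div_mul_cancel₀ _ hDpos.ne'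
    have hs0 : 0 ≤ s := div_nonneg hdi.le hD0
    have hs1 : s ≤ 1 := by
      rw [hs, div_le_one hDpos, ← hmaxi]
      exact Finset.single_le_sum (f := fun j => max (r - ρ j) 0) (fun j _ => le_max_right _ _) hi
    have hmix : receiverMean ρ (C.erase i) ≤ (1 - s) * r + s * ρ z := by
      have h1 : m' * (receiverMean ρ (C.erase i) - r) ≤ s * (m' * (ρ z - r)) := by
        have h2 : m' * (receiverMean ρ (C.erase i) - r) ≤ r - ρ i := by
          linarith
        nlinarith [mul_le_mul_of_nonneg_left hDplus hs0]
      have h3 : m' * (receiverMean ρ (C.erase i) - r) ≤ m' * (s * (ρ z - r)) := by linarith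
      have := le_of_mul_le_mul_left h3 hm'pos
      linarith
    have mixSum : ∀ u : Fin n → ℝ,
        ∑ j ∈ C.erase i, ((1 - s) * P.returnProb C j + if j = z then s else 0) * u j =
          (1 - s) * P.returned u C + s * u z := by
      intro u
      simp only [add_mul, Finset.sum_add_distrib, mul_assoc, ite_mul, zero_mul,
        Finset.sum_ite_eq', if_pos hz]
      rw [← Finset.mul_sum, sumErase]
    have mixSum1 := mixSum fun _ => 1
    simp only [mul_one] at mixSum1
    have h1 := P.sum_le_returned hξ hne
      (y := fun j => (1 - s) * P.returnProb C j + if j = z then s else 0)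
      (fun j _ => add_nonneg (mul_nonneg (by linarith) (hq0 j)) (by split_ifs <;> linarith))
      (by rw [mixSum1, returned]; simp only [mul_one]; rw [P.sum_returnProb hC]; ring)
      (by rw [mixSum]; exact hmix)
    rw [mixSum] at h1
    rw [hmaxi, ← hs]
    nlinarith [mul_nonneg hs0 (hξ z)]

/-- Of the loss of 3, at most 2 comes from discarding the terms of `a` and `b`, and at most 1 from
the shares of the shortfall. -/
theorem sum_returned_erase_ge (hξ : ∀ i, 0 ≤ ξ i) (hcard : 2 ≤ C.card) :
    ((C.card : ℝ) - 3) * P.returned ξ C ≤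
      ∑ i ∈ C, (1 - P.returnProb C i) * P.returned ξ (C.erase i) := by
  have hC : C.Nonempty := Finset.card_pos.1 (by omega)
  have hV := P.returned_nonneg hC hξ
  set r := P.returned ρ C
  set D := ∑ j ∈ C, max (r - ρ j) 0 with hD
  have hD0 : 0 ≤ D := Finset.sum_nonneg fun j _ => le_max_right _ _
  have hterm : ∀ i ∈ C, (1 - (if i ∈ ({P.a C, P.b C} : Finset (Fin n)) then 1 else 0)
      - max (r - ρ i) 0 / D) * P.returned ξ C ≤
        (1 - P.returnProb C i) * P.returned ξ (C.erase i) := by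
    intro i hi
    have hne : (C.erase i).Nonempty :=
      Finset.card_pos.1 (by rw [Finset.card_erase_of_mem hi]; omega)
    split_ifs with hab
    · have h1 : 0 ≤ max (r - ρ i) 0 / D := div_nonneg (le_max_right _ _) hD0
      have h2 := P.returned_nonneg hne hξ
      have h3 := (P.returnProb_mem C hC i).2
      have h4 := mul_nonneg (sub_nonneg.2 h3) h2
      nlinarith
    · simp only [Finset.mem_insert, Finset.mem_singleton, not_or] at hab
      have hq := P.returnProb_eq_zero hab.1 hab.2
      simp only [hq, sub_zero, one_mul]
      exact P.returned_erase_ge hξ hi hne hq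
  refine le_trans ?_ (Finset.sum_le_sum hterm)
  rw [← Finset.sum_mul]
  refine mul_le_mul_of_nonneg_right ?_ hV
  rw [Finset.sum_sub_distrib, Finset.sum_sub_distrib, Finset.sum_const, nsmul_eq_mul, mul_one,
    ← Finset.sum_div, ← hD]
  have h1 : D / D ≤ 1 := div_self_le_one D
  have h2 : ∑ i ∈ C, (if i ∈ ({P.a C, P.b C} : Finset (Fin n)) then (1 : ℝ) else 0) ≤ 2 := by
    rw [Finset.sum_boole]
    have h3 : (C.filter fun i => i ∈ ({P.a C, P.b C} : Finset (Fin n))).card ≤ 2 :=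
      (Finset.card_le_card fun i hi => (Finset.mem_filter.1 hi).2).trans Finset.card_le_two
    exact_mod_cast h3
  linarith

/-- Expected utility `u` of the candidate hired by an obedient receiver when the set of the `k`
remaining candidates is `C`, times `k!`. -/
noncomputable def value (u : Fin n → ℝ) : ℕ → Finset (Fin n) → ℝ
  | 0, _ => 0
  | k + 1, C => k.factorial * P.returned u C +
      ∑ i ∈ C, (1 - P.returnProb C i) * value u k (C.erase i)

theorem factorial_mul_returned_le_value (hξ : ∀ i, 0 ≤ ξ i) (k : ℕ) :
    ∀ C : Finset (Fin n), C.card = k → k.factorial * P.returned ξ C ≤ 3 * P.value ξ k C := by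
  induction k with
  | zero =>
    intro C hC
    rw [Finset.card_eq_zero.1 hC]
    simp [returned, value]
  | succ k ih =>
    intro C hcard
    have hC : C.Nonempty := Finset.card_pos.1 (by omega)
    have hV := P.returned_nonneg hC hξ
    have hfac : (0 : ℝ) < k.factorial := by exact_mod_cast k.factorial_pos
    have hsum : k.factorial * ∑ i ∈ C, (1 - P.returnProb C i) * P.returned ξ (C.erase i) ≤
        3 * ∑ i ∈ C, (1 - P.returnProb C i) * P.value ξ k (C.erase i) := by
      rw [Finset.mul_sum, Finset.mul_sum]
      refine Finset.sum_le_sum fun i hi => ?_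
      have h1 := ih (C.erase i) (by rw [Finset.card_erase_of_mem hi]; omega)
      have h2 := mul_le_mul_of_nonneg_left h1 (sub_nonneg.2 (P.returnProb_mem C hC i).2)
      linarith
    have hlow : ((k : ℝ) + 1 - 3) * P.returned ξ C ≤
        ∑ i ∈ C, (1 - P.returnProb C i) * P.returned ξ (C.erase i) := by
      -- For one candidate the coefficient is -2 and the right side vanishes.
      rcases k.eq_zero_or_pos with rfl | hpos
      · obtain ⟨i, rfl⟩ := Finset.card_eq_one.1 hcard
        have : P.returned ξ ∅ = 0 := by simp [returned]
        simp only [Finset.sum_singleton, Finset.erase_singleton, this]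
        push_cast
        linarith
      · have := P.sum_returned_erase_ge hξ (C := C) (by omega)
        rw [hcard] at this
        push_cast at this
        exact this
    -- The constant 3 closes the induction: `3 + (k + 1 - 3) = k + 1`.
    have := mul_le_mul_of_nonneg_left hlow hfac.le
    rw [value, Nat.factorial_succ]
    push_cast
    linarith

/-! ### Incentives of the receiver -/

theorem sum_one_sub_returnProb_mul (u : Fin n → ℝ) (C : Finset (Fin n)) :
    ∑ i ∈ C, (1 - P.returnProb C i) * u i = ∑ i ∈ C, u i - P.returned u C := by
  simp only [sub_mul, one_mul, Finset.sum_sub_distrib, returned]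

/-- For rejecting upon HIRE: `k` times the left side is (k+1)μ - r, at most k r because μ ≤ r. -/
theorem sum_returnProb_mul_mean_erase_le (hρ : ∀ i, 0 ≤ ρ i) {k : ℕ} (hk : C.card = k + 1) :
    ∑ i ∈ C, P.returnProb C i * receiverMean ρ (C.erase i) ≤ P.returned ρ C := by
  have hC : C.Nonempty := Finset.card_pos.1 (by omega)
  have hμ := P.mean_le_returned hC
  rcases k.eq_zero_or_pos with rfl | hpos
  · obtain ⟨i, rfl⟩ := Finset.card_eq_one.1 hk
    simpa [receiverMean] using P.returned_nonneg hC hρ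
  · have hk0 : (0 : ℝ) < k := by exact_mod_cast hpos
    have h : (k : ℝ) * ∑ i ∈ C, P.returnProb C i * receiverMean ρ (C.erase i) =
        (k + 1) * receiverMean ρ C - P.returned ρ C := by
      rw [Finset.mul_sum]
      calc _ = ∑ i ∈ C, (P.returnProb C i * ((k + 1) * receiverMean ρ C)
              - P.returnProb C i * ρ i) := Finset.sum_congr rfl fun i hi => by
            rw [mul_left_comm, mul_receiverMean_erase ρ hk hi, mul_sub]
        _ = _ := by
            rw [Finset.sum_sub_distrib, ← Finset.sum_mul, P.sum_returnProb hC, one_mul, returned]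
    refine le_of_mul_le_mul_left (h.le.trans ?_) hk0
    nlinarith

theorem mul_sum_one_sub_returnProb_mul_mean_erase {k : ℕ} (hk : C.card = k + 1) :
    (k : ℝ) * ∑ i ∈ C, (1 - P.returnProb C i) * receiverMean ρ (C.erase i) =
      (k + 1) * k * receiverMean ρ C - ((k + 1) * receiverMean ρ C - P.returned ρ C) := by
  have hC : C.Nonempty := Finset.card_pos.1 (by omega)
  have hsum := P.sum_one_sub_returnProb_mul ρ C
  rw [← card_mul_receiverMean ρ C, hk] at hsum
  push_cast at hsum
  rw [Finset.mul_sum, ← hsum]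
  calc _ = ∑ i ∈ C, ((1 - P.returnProb C i) * ((k + 1) * receiverMean ρ C)
          - (1 - P.returnProb C i) * ρ i) := Finset.sum_congr rfl fun i hi => by
        rw [mul_left_comm, mul_receiverMean_erase ρ hk hi, mul_sub]
    _ = _ := by
        rw [Finset.sum_sub_distrib, ← Finset.sum_mul, Finset.sum_sub_distrib, P.sum_returnProb hC,
          Finset.sum_const, hk, nsmul_eq_mul]
        push_cast
        ring

/-- Obedience is worth at least hiring blindly. The surplus r - μ of hiring now compensates for what
the selection takes from the pool. -/
theorem factorial_mul_mean_le_value (k : ℕ) :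
    ∀ C : Finset (Fin n), C.card = k → k.factorial * receiverMean ρ C ≤ P.value ρ k C := by
  induction k with
  | zero =>
    intro C hC
    rw [Finset.card_eq_zero.1 hC]
    simp [receiverMean, value]
  | succ k ih =>
    intro C hcard
    have hC : C.Nonempty := Finset.card_pos.1 (by omega)
    have hμ := P.mean_le_returned hC
    have hfac : (0 : ℝ) < k.factorial := by exact_mod_cast k.factorial_pos
    have hsum : k.factorial * ∑ i ∈ C, (1 - P.returnProb C i) * receiverMean ρ (C.erase i) ≤
        ∑ i ∈ C, (1 - P.returnProb C i) * P.value ρ k (C.erase i) := by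
      rw [Finset.mul_sum]
      refine Finset.sum_le_sum fun i hi => ?_
      rw [mul_left_comm]
      exact mul_le_mul_of_nonneg_left (ih _ (by rw [Finset.card_erase_of_mem hi]; omega))
        (sub_nonneg.2 (P.returnProb_mem C hC i).2)
    have hlow : k * receiverMean ρ C ≤ (P.returned ρ C - receiverMean ρ C) +
        ∑ i ∈ C, (1 - P.returnProb C i) * receiverMean ρ (C.erase i) := by
      rcases k.eq_zero_or_pos with rfl | hpos
      · obtain ⟨i, rfl⟩ := Finset.card_eq_one.1 hcard
        have : receiverMean ρ (∅ : Finset (Fin n)) = 0 := by simp [receiverMean]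
        simp only [Finset.sum_singleton, Finset.erase_singleton, this]
        push_cast
        linarith
      · have hk0 : (0 : ℝ) < k := by exact_mod_cast hpos
        have h := P.mul_sum_one_sub_returnProb_mul_mean_erase hcard
        refine le_of_mul_le_mul_left ?_ hk0
        rw [mul_add, h]
        nlinarith
    have := mul_le_mul_of_nonneg_left hlow hfac.le
    rw [value, Nat.factorial_succ]
    push_cast
    linarith

/-- For hiring upon NOT: since r ≥ μ, the candidates signaled NOT are on average no better than the
mean of the others, which obedient continuation guarantees. -/
theorem factorial_mul_sum_one_sub_returnProb_le {k : ℕ}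
    (hk : C.card = k + 1) :
    ∑ i ∈ C, (1 - P.returnProb C i) * (k.factorial * ρ i) ≤
      ∑ i ∈ C, (1 - P.returnProb C i) * P.value ρ k (C.erase i) := by
  have hC : C.Nonempty := Finset.card_pos.1 (by omega)
  have hμ := P.mean_le_returned hC
  rcases k.eq_zero_or_pos with rfl | hpos
  · obtain ⟨i, rfl⟩ := Finset.card_eq_one.1 hk
    have := P.sum_returnProb hC
    simp only [Finset.sum_singleton] at this
    simp [this]
  have hfac : (0 : ℝ) < k.factorial := by exact_mod_cast k.factorial_pos
  have hk0 : (0 : ℝ) < k := by exact_mod_cast hpos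
  have hmean : ∑ i ∈ C, (1 - P.returnProb C i) * ρ i ≤
      ∑ i ∈ C, (1 - P.returnProb C i) * receiverMean ρ (C.erase i) := by
    refine le_of_mul_le_mul_left ?_ hk0
    rw [P.mul_sum_one_sub_returnProb_mul_mean_erase hk, P.sum_one_sub_returnProb_mul,
      ← card_mul_receiverMean, hk]
    push_cast
    nlinarith
  calc _ = k.factorial * ∑ i ∈ C, (1 - P.returnProb C i) * ρ i := by
        rw [Finset.mul_sum]; exact Finset.sum_congr rfl fun i _ => by ring
    _ ≤ k.factorial * ∑ i ∈ C, (1 - P.returnProb C i) * receiverMean ρ (C.erase i) :=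
        mul_le_mul_of_nonneg_left hmean hfac.le
    _ ≤ _ := by
        rw [Finset.mul_sum]
        refine Finset.sum_le_sum fun i hi => ?_
        rw [mul_left_comm]
        exact mul_le_mul_of_nonneg_left (P.factorial_mul_mean_le_value k _
          (by rw [Finset.card_erase_of_mem hi]; omega))
          (sub_nonneg.2 (P.returnProb_mem C hC i).2)

end ParetoProcedure

/-! ### Payoffs along the process -/

/-- `payoffFrom` for a round number that may exceed the last round. -/
noncomputable def payoffAfter {disclosure : Bool} (u : Fin n → ℝ)
    (d : ReceiverStrategy n disclosure) (t₀ : ℕ) (θ : Equiv.Perm (Fin n))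
    (σ : Fin n → Bool) : ℝ :=
  open Classical in
  ∑ t : Fin n, if t₀ ≤ (t : ℕ) ∧ d.hires t θ σ = true ∧
      (∀ s : Fin n, t₀ ≤ (s : ℕ) → s < t → d.hires s θ σ = false)
    then u (θ t) else 0

theorem payoffFrom_eq_payoffAfter {disclosure : Bool} (u : Fin n → ℝ)
    (d : ReceiverStrategy n disclosure) (t : Fin n) :
    payoffFrom u d t = payoffAfter u d t := rfl

theorem payoffAfter_of_le {disclosure : Bool} (u : Fin n → ℝ)
    (d : ReceiverStrategy n disclosure) {t : ℕ} (ht : n ≤ t) (θ : Equiv.Perm (Fin n))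
    (σ : Fin n → Bool) : payoffAfter u d t θ σ = 0 := by
  classical
  refine Finset.sum_eq_zero fun s _ => if_neg ?_
  have := s.2
  rintro ⟨h, -⟩
  omega

theorem payoffAfter_of_hires {disclosure : Bool} (u : Fin n → ℝ)
    (d : ReceiverStrategy n disclosure) {t : Fin n} {θ : Equiv.Perm (Fin n)} {σ : Fin n → Bool}
    (h : d.hires t θ σ = true) : payoffAfter u d t θ σ = u (θ t) := by
  classical
  unfold payoffAfter
  rw [Finset.sum_eq_single_of_mem t (Finset.mem_univ t), if_pos]
  · exact ⟨le_rfl, h, fun s h1 h2 => absurd h2 (not_lt.2 h1)⟩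
  · rintro s - hs
    refine if_neg ?_
    rintro ⟨h1, -, h2⟩
    have := h2 t le_rfl (lt_of_le_of_ne h1 hs.symm)
    simp [h] at this

theorem payoffAfter_of_rejects {disclosure : Bool} (u : Fin n → ℝ)
    (d : ReceiverStrategy n disclosure) {t : Fin n} {θ : Equiv.Perm (Fin n)} {σ : Fin n → Bool}
    (h : d.hires t θ σ = false) : payoffAfter u d t θ σ = payoffAfter u d (t + 1) θ σ := by
  classical
  unfold payoffAfter
  refine Finset.sum_congr rfl fun s _ => ?_
  congr 1
  refine propext ⟨?_, ?_⟩
  · rintro ⟨h1, h2, h3⟩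
    refine ⟨Nat.lt_of_le_of_ne h1 fun heq => ?_, h2, fun r hr => h3 r (by omega)⟩
    rw [Fin.ext heq, h2] at h
    simp at h
  · rintro ⟨h1, h2, h3⟩
    refine ⟨by omega, h2, fun r hr hrs => ?_⟩
    rcases Nat.eq_or_lt_of_le hr with heq | hlt
    · rw [← Fin.ext heq]; exact h
    · exact h3 r hlt hrs

/-- The receiver does not know the candidate of round `t`, so her decision is the same for every
arrival `i`. -/
theorem ReceiverStrategy.hires_eq_of_agree (d : ReceiverStrategy n true) {t i : Fin n}
    {θ₀ θ : Equiv.Perm (Fin n)} {σ₀ σ : Fin n → Bool} (hi : i ∈ remainingFrom t θ₀)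
    (h : AgreeBefore (t + 1) (arrive θ₀ t i) θ σ₀ σ) : d.hires t θ σ = d.hires t θ₀ σ₀ := by
  refine d.adapted _ _ _ _ _ ⟨fun s hs => (h s (Nat.lt_succ_of_le hs)).2.symm, fun _ s hs => ?_⟩
  rw [← (h s (Nat.lt_succ_of_lt hs)).1, arrive_of_lt hi hs]

theorem DirectMechanism.informed_of_hires (φ : DirectMechanism n) (u : Fin n → ℝ)
    (d : ReceiverStrategy n true) {t : Fin n} {k : ℕ} (hk : n = t + 1 + k)
    {θ₀ : Equiv.Perm (Fin n)} {σ₀ : Fin n → Bool} (h : d.hires t θ₀ σ₀ = true) :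
    φ.informed t θ₀ σ₀ (payoffAfter u d t) = ∑ i ∈ remainingFrom t θ₀,
      φ.signalProb t (arrive θ₀ t i) σ₀ * (k.factorial * u i) := by
  rw [φ.informed_eq]
  refine Finset.sum_congr rfl fun i hi => ?_
  rw [← φ.continuation_const (u i) k (t + 1) (arrive θ₀ t i) σ₀ hk]
  congr 1
  refine φ.continuation_congr fun θ σ hag => ?_
  rw [payoffAfter_of_hires u d ((d.hires_eq_of_agree hi hag).trans h),
    ← (hag t (Nat.lt_succ_self _)).1, arrive_self]

theorem DirectMechanism.informed_of_rejects (φ : DirectMechanism n) (u : Fin n → ℝ)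
    (d : ReceiverStrategy n true) {t : Fin n}
    {θ₀ : Equiv.Perm (Fin n)} {σ₀ : Fin n → Bool} (h : d.hires t θ₀ σ₀ = false) :
    φ.informed t θ₀ σ₀ (payoffAfter u d t) = ∑ i ∈ remainingFrom t θ₀,
      φ.signalProb t (arrive θ₀ t i) σ₀ *
        φ.continuation (t + 1) (arrive θ₀ t i) σ₀ (payoffAfter u d (t + 1)) := by
  rw [φ.informed_eq]
  refine Finset.sum_congr rfl fun i hi => ?_
  congr 1
  refine φ.continuation_congr fun θ σ hag => ?_
  rw [payoffAfter_of_rejects u d ((d.hires_eq_of_agree hi hag).trans h)]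

theorem obedientPayoff_eq_payoffAfter (disclosure : Bool) (u : Fin n → ℝ) :
    obedientPayoff u = payoffAfter u (obedient n disclosure) 0 := by
  classical
  funext θ σ
  simp [obedientPayoff, payoffAfter, obedient]

/-! ### The Shrinking Pareto mechanism -/

namespace ParetoProcedure

variable {ρ ξ : Fin n → ℝ} (P : ParetoProcedure ρ ξ)

theorem signalProb_of_hired {t : Fin n} {σ : Fin n → Bool} (h : ∃ s, s < t ∧ σ s = true)
    (θ : Equiv.Perm (Fin n)) :
    P.shrinkingPareto.signalProb t θ σ = if σ t = true then 0 else 1 := by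
  have : P.shrinkingPareto.hireProb t θ σ = 0 := if_pos h
  simp [DirectMechanism.signalProb, this]

theorem signalProb_arrive {t i : Fin n} {θ : Equiv.Perm (Fin n)} {σ : Fin n → Bool}
    (hσ : ∀ s, s < t → σ s = false) (hi : i ∈ remainingFrom t θ) :
    P.shrinkingPareto.signalProb t (arrive θ t i) σ =
      if σ t = true then P.returnProb (remainingFrom t θ) i
      else 1 - P.returnProb (remainingFrom t θ) i := by
  have hno : ¬ ∃ s, s < t ∧ σ s = true := by
    rintro ⟨s, hs, h⟩
    simp [hσ s hs] at h
  have : P.shrinkingPareto.hireProb t (arrive θ t i) σ = P.returnProb (remainingFrom t θ) i := by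
    refine (if_neg hno).trans ?_
    rw [remaining_eq_remainingFrom, arrive_self,
      remainingFrom_congr fun s hs => arrive_of_lt hi hs]
  simp [DirectMechanism.signalProb, this]

/-- After a HIRE all signals are NOT. The remaining order is then uniform whatever is observed, and
the mean of the remaining candidates is a martingale, so stopping cannot beat it. -/
theorem continuation_le_of_hired (hρ : ∀ i, 0 ≤ ρ i) (d : ReceiverStrategy n true) (k : ℕ) :
    ∀ (t : ℕ) (θ₀ : Equiv.Perm (Fin n)) (σ₀ : Fin n → Bool), n = t + k →
      (∃ s : Fin n, (s : ℕ) < t ∧ σ₀ s = true) →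
      P.shrinkingPareto.continuation t θ₀ σ₀ (payoffAfter ρ d t) ≤
        k.factorial * receiverMean ρ (remainingFrom t θ₀) := by
  induction k with
  | zero =>
    intro t θ₀ σ₀ hn _
    rw [DirectMechanism.continuation_of_le _ (by omega), payoffAfter_of_le _ _ (by omega)]
    exact mul_nonneg (Nat.cast_nonneg _) (receiverMean_nonneg hρ _)
  | succ k ih =>
    intro t' θ₀ σ₀ hn hσ
    obtain ⟨t, rfl⟩ : ∃ t : Fin n, (t : ℕ) = t' := ⟨⟨t', by omega⟩, rfl⟩
    have hex : ∀ b, ∃ s : Fin n, s < t ∧ Function.update σ₀ t b s = true := by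
      intro b
      obtain ⟨s, hs, h⟩ := hσ
      exact ⟨s, hs, by rw [Function.update_of_ne (Fin.ne_of_lt hs)]; exact h⟩
    have hcard : (remainingFrom t θ₀).card = k + 1 := by rw [card_remainingFrom]; omega
    have hfac : (0 : ℝ) ≤ k.factorial := Nat.cast_nonneg _
    rw [DirectMechanism.continuation_eq_informed,
      DirectMechanism.informed_eq _ t θ₀ (Function.update σ₀ t true)]
    have h0 : ∀ θ, P.shrinkingPareto.signalProb t θ (Function.update σ₀ t true) = 0 := fun θ => by
      rw [P.signalProb_of_hired (hex true)]; simp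
    have h1 : ∀ θ, P.shrinkingPareto.signalProb t θ (Function.update σ₀ t false) = 1 := fun θ => by
      rw [P.signalProb_of_hired (hex false)]; simp
    simp only [h0, zero_mul, Finset.sum_const_zero, zero_add]
    cases hd : d.hires t θ₀ (Function.update σ₀ t false) with
    | true =>
      rw [DirectMechanism.informed_of_hires _ _ _ (k := k) (by omega) hd]
      simp only [h1, one_mul]
      rw [← Finset.mul_sum, ← card_mul_receiverMean, hcard, Nat.factorial_succ]
      push_cast
      linarith
    | false =>
      rw [DirectMechanism.informed_of_rejects _ _ _ hd]
      simp only [h1, one_mul]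
      calc _ ≤ ∑ i ∈ remainingFrom t θ₀,
            (k.factorial : ℝ) * receiverMean ρ ((remainingFrom t θ₀).erase i) := by
            refine Finset.sum_le_sum fun i hi => ?_
            rw [← remainingFrom_arrive hi]
            obtain ⟨s, hs, h⟩ := hex false
            exact ih (t + 1) _ _ (by omega) ⟨s, Nat.lt_succ_of_lt hs, h⟩
        _ ≤ k.factorial * ((k + 1) * receiverMean ρ (remainingFrom t θ₀)) := by
            rw [← Finset.mul_sum]
            exact mul_le_mul_of_nonneg_left (sum_receiverMean_erase_le hρ hcard) hfac
        _ = _ := by rw [Nat.factorial_succ]; push_cast; ring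

theorem informed_hire_le (hρ : ∀ i, 0 ≤ ρ i) (d : ReceiverStrategy n true) {t : Fin n} {k : ℕ}
    (hk : n = t + 1 + k) {θ₀ : Equiv.Perm (Fin n)} {σ₀ : Fin n → Bool}
    (hσ : ∀ s, s < t → σ₀ s = false) (ht : σ₀ t = true) :
    P.shrinkingPareto.informed t θ₀ σ₀ (payoffAfter ρ d t) ≤
      k.factorial * P.returned ρ (remainingFrom t θ₀) := by
  have hcard : (remainingFrom t θ₀).card = k + 1 := by rw [card_remainingFrom]; omega
  have hC : (remainingFrom t θ₀).Nonempty := Finset.card_pos.1 (by omega)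
  cases hd : d.hires t θ₀ σ₀ with
  | true =>
    rw [DirectMechanism.informed_of_hires _ _ _ hk hd, returned, Finset.mul_sum]
    refine Finset.sum_le_sum fun i hi => ?_
    rw [P.signalProb_arrive hσ hi, if_pos ht]
    linarith
  | false =>
    rw [DirectMechanism.informed_of_rejects _ _ _ hd]
    refine le_trans ?_ (mul_le_mul_of_nonneg_left (P.sum_returnProb_mul_mean_erase_le hρ hcard)
      (Nat.cast_nonneg _))
    rw [Finset.mul_sum]
    refine Finset.sum_le_sum fun i hi => ?_
    rw [P.signalProb_arrive hσ hi, if_pos ht, mul_left_comm, ← remainingFrom_arrive hi]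
    exact mul_le_mul_of_nonneg_left
      (P.continuation_le_of_hired hρ d k _ _ _ hk ⟨t, Nat.lt_succ_self _, ht⟩)
      (P.returnProb_mem _ hC i).1

theorem informed_not_le {d : ReceiverStrategy n true} {t : Fin n} {k : ℕ}
    (hk : n = t + 1 + k) {θ₀ : Equiv.Perm (Fin n)} {σ₀ : Fin n → Bool}
    (hσ : ∀ s, s ≤ t → σ₀ s = false)
    (ih : ∀ θ, P.shrinkingPareto.continuation (t + 1) θ σ₀ (payoffAfter ρ d (t + 1)) ≤
      P.value ρ k (remainingFrom (t + 1) θ)) :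
    P.shrinkingPareto.informed t θ₀ σ₀ (payoffAfter ρ d t) ≤
      ∑ i ∈ remainingFrom t θ₀, (1 - P.returnProb (remainingFrom t θ₀) i) *
        P.value ρ k ((remainingFrom t θ₀).erase i) := by
  have hcard : (remainingFrom t θ₀).card = k + 1 := by rw [card_remainingFrom]; omega
  have hC : (remainingFrom t θ₀).Nonempty := Finset.card_pos.1 (by omega)
  have hprob : ∀ i ∈ remainingFrom t θ₀, P.shrinkingPareto.signalProb t (arrive θ₀ t i) σ₀ =
      1 - P.returnProb (remainingFrom t θ₀) i := by
    intro i hi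
    rw [P.signalProb_arrive (fun s hs => hσ s hs.le) hi, if_neg (by simp [hσ t le_rfl])]
  cases hd : d.hires t θ₀ σ₀ with
  | true =>
    rw [DirectMechanism.informed_of_hires _ _ _ hk hd,
      Finset.sum_congr rfl fun i hi => by rw [hprob i hi]]
    exact P.factorial_mul_sum_one_sub_returnProb_le hcard
  | false =>
    rw [DirectMechanism.informed_of_rejects _ _ _ hd]
    refine Finset.sum_le_sum fun i hi => ?_
    rw [hprob i hi, ← remainingFrom_arrive hi]
    exact mul_le_mul_of_nonneg_left (ih _) (sub_nonneg.2 (P.returnProb_mem _ hC i).2)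

theorem update_false_of_le {t : Fin n} {σ : Fin n → Bool} (hσ : ∀ s, s < t → σ s = false) :
    ∀ s, s ≤ t → Function.update σ t false s = false := by
  intro s hs
  rcases hs.lt_or_eq with h | rfl
  · rw [Function.update_of_ne h.ne]; exact hσ s h
  · simp

/-- Backward induction over all strategies: the bounds after HIRE and after NOT are the two summands
of `value`. -/
theorem continuation_le_value (hρ : ∀ i, 0 ≤ ρ i) (d : ReceiverStrategy n true) (k : ℕ) :
    ∀ (t : ℕ) (θ₀ : Equiv.Perm (Fin n)) (σ₀ : Fin n → Bool), n = t + k →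
      (∀ s : Fin n, (s : ℕ) < t → σ₀ s = false) →
      P.shrinkingPareto.continuation t θ₀ σ₀ (payoffAfter ρ d t) ≤
        P.value ρ k (remainingFrom t θ₀) := by
  induction k with
  | zero =>
    intro t θ₀ σ₀ hn _
    rw [DirectMechanism.continuation_of_le _ (by omega), payoffAfter_of_le _ _ (by omega), value]
  | succ k ih =>
    intro t' θ₀ σ₀ hn hσ
    obtain ⟨t, rfl⟩ : ∃ t : Fin n, (t : ℕ) = t' := ⟨⟨t', by omega⟩, rfl⟩
    rw [DirectMechanism.continuation_eq_informed, value]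
    have hfalse := update_false_of_le hσ
    refine add_le_add (P.informed_hire_le hρ d (by omega) (fun s hs => ?_) (by simp))
      (P.informed_not_le (by omega) hfalse fun θ => ih _ _ _ (by omega)
        fun s hs => hfalse s (Nat.le_of_lt_succ hs))
    rw [Function.update_of_ne hs.ne]
    exact hσ s hs

/-! ### Obedience attains the bounds -/

theorem informed_obedient_hire (u : Fin n → ℝ) {t : Fin n} {k : ℕ}
    (hk : n = t + 1 + k) {θ₀ : Equiv.Perm (Fin n)} {σ₀ : Fin n → Bool}
    (hσ : ∀ s, s < t → σ₀ s = false) (ht : σ₀ t = true) :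
    P.shrinkingPareto.informed t θ₀ σ₀ (payoffAfter u (obedient n true) t) =
      k.factorial * P.returned u (remainingFrom t θ₀) := by
  rw [DirectMechanism.informed_of_hires _ _ _ hk (by exact ht), returned, Finset.mul_sum]
  refine Finset.sum_congr rfl fun i hi => ?_
  rw [P.signalProb_arrive hσ hi, if_pos ht]
  ring

theorem informed_obedient_not (u : Fin n → ℝ) {t : Fin n} {k : ℕ}
    {θ₀ : Equiv.Perm (Fin n)} {σ₀ : Fin n → Bool} (hσ : ∀ s, s ≤ t → σ₀ s = false)
    (ih : ∀ θ, P.shrinkingPareto.continuation (t + 1) θ σ₀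
      (payoffAfter u (obedient n true) (t + 1)) = P.value u k (remainingFrom (t + 1) θ)) :
    P.shrinkingPareto.informed t θ₀ σ₀ (payoffAfter u (obedient n true) t) =
      ∑ i ∈ remainingFrom t θ₀, (1 - P.returnProb (remainingFrom t θ₀) i) *
        P.value u k ((remainingFrom t θ₀).erase i) := by
  rw [DirectMechanism.informed_of_rejects _ _ _ (by exact hσ t le_rfl)]
  refine Finset.sum_congr rfl fun i hi => ?_
  rw [P.signalProb_arrive (fun s hs => hσ s hs.le) hi, if_neg (by simp [hσ t le_rfl]), ih,
    remainingFrom_arrive hi]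

theorem continuation_obedient (u : Fin n → ℝ) (k : ℕ) :
    ∀ (t : ℕ) (θ₀ : Equiv.Perm (Fin n)) (σ₀ : Fin n → Bool), n = t + k →
      (∀ s : Fin n, (s : ℕ) < t → σ₀ s = false) →
      P.shrinkingPareto.continuation t θ₀ σ₀ (payoffAfter u (obedient n true) t) =
        P.value u k (remainingFrom t θ₀) := by
  induction k with
  | zero =>
    intro t θ₀ σ₀ hn _
    rw [DirectMechanism.continuation_of_le _ (by omega), payoffAfter_of_le _ _ (by omega), value]
  | succ k ih =>
    intro t' θ₀ σ₀ hn hσ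
    obtain ⟨t, rfl⟩ : ∃ t : Fin n, (t : ℕ) = t' := ⟨⟨t', by omega⟩, rfl⟩
    have hfalse := update_false_of_le hσ
    rw [DirectMechanism.continuation_eq_informed, value,
      P.informed_obedient_hire u (k := k) (by omega) (fun s hs => by
        rw [Function.update_of_ne hs.ne]; exact hσ s hs) (by simp),
      P.informed_obedient_not u (k := k) hfalse fun θ => ih _ _ _ (by omega)
        fun s hs => hfalse s (Nat.le_of_lt_succ hs)]

theorem persuasive_shrinkingPareto (hρ : ∀ i, 0 ≤ ρ i) :
    Persuasive true ρ P.shrinkingPareto := by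
  intro t θ₀ σ₀ hσ d
  obtain ⟨k, hk⟩ : ∃ k, n = t + 1 + k := ⟨n - (t + 1), by have := t.2; omega⟩
  rw [utilityAt_eq_informed, utilityAt_eq_informed]
  refine mul_le_mul_of_nonneg_left ?_ (mul_nonneg (by positivity)
    (Finset.prod_nonneg fun s _ => DirectMechanism.signalProb_nonneg _ _ _ _))
  rw [payoffFrom_eq_payoffAfter, payoffFrom_eq_payoffAfter]
  cases ht : σ₀ t with
  | true =>
    rw [P.informed_obedient_hire ρ hk hσ ht]
    exact P.informed_hire_le hρ d hk hσ ht
  | false =>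
    have hσ' : ∀ s, s ≤ t → σ₀ s = false := by
      intro s hs
      rcases hs.lt_or_eq with h | rfl
      · exact hσ s h
      · exact ht
    rw [P.informed_obedient_not ρ (k := k) hσ' fun θ => P.continuation_obedient ρ k _ _ _ hk
      fun s hs => hσ' s (Nat.le_of_lt_succ hs)]
    exact P.informed_not_le hk hσ' fun θ => P.continuation_le_value hρ d k _ _ _ hk
      fun s hs => hσ' s (Nat.le_of_lt_succ hs)

theorem senderUtility_shrinkingPareto (u : Fin n → ℝ) :
    senderUtility u P.shrinkingPareto =
      1 / (n.factorial : ℝ) * P.value u n Finset.univ := by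
  unfold senderUtility
  rw [DirectMechanism.continuation_zero _ 1 (fun _ => false), obedientPayoff_eq_payoffAfter true,
    P.continuation_obedient u n 0 _ _ (by omega) (fun _ _ => rfl), remainingFrom_zero]

end ParetoProcedure

/-! ### The benchmark -/

theorem DirectMechanism.sum_law_mul_const (φ : DirectMechanism n) (c : ℝ) :
    ∑ θ, ∑ σ, φ.law θ σ * c = c := by
  rw [φ.continuation_zero 1 (fun _ => false), φ.continuation_const c n 0 _ _ (by omega)]
  have : (n.factorial : ℝ) ≠ 0 := by exact_mod_cast n.factorial_ne_zero
  field_simp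

/-- Hire the first candidate, whatever the signals say. -/
def hireAlways (n : ℕ) (disclosure : Bool) : ReceiverStrategy n disclosure where
  hires _ _ _ := true
  adapted _ _ _ _ _ _ := rfl

theorem sum_law_mul_first (φ : DirectMechanism n) (u : Fin n → ℝ) (t : Fin n)
    (ht : (t : ℕ) = 0) :
    ∑ θ, ∑ σ, φ.law θ σ * payoffFrom u (hireAlways n false) t θ σ =
      receiverMean u Finset.univ := by
  obtain ⟨k, hk⟩ : ∃ k, n = t + 1 + k := ⟨n - (t + 1), by have := t.2; omega⟩
  -- This strategy ignores all information, so the recursions for disclosure apply to it.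
  have hpay : payoffFrom u (hireAlways n false) t = payoffAfter u (hireAlways n true) t := rfl
  rw [φ.continuation_zero 1 (fun _ => false), hpay, ← ht, φ.continuation_eq_informed,
    φ.informed_of_hires u _ hk (by rfl), φ.informed_of_hires u _ hk (by rfl),
    ← Finset.sum_add_distrib]
  simp only [← add_mul, φ.signalProb_add, one_mul]
  rw [ht, remainingFrom_zero, ← Finset.mul_sum, ← card_mul_receiverMean, Finset.card_univ,
    Fintype.card_fin]
  have h1 : (n.factorial : ℝ) = n * k.factorial := by
    have : n = k + 1 := by omega
    rw [this, Nat.factorial_succ]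
    push_cast
    ring
  have h2 : (n.factorial : ℝ) ≠ 0 := by exact_mod_cast n.factorial_ne_zero
  rw [← mul_assoc (k.factorial : ℝ), mul_comm (k.factorial : ℝ), ← h1, ← mul_assoc,
    one_div_mul_cancel h2, one_mul]

/-- Without disclosure the first signal is all that is known in the first round, so its two values
partition all outcomes; the order `1` is an arbitrary representative. -/
theorem sum_law_mul_payoffFrom (ρ : Fin n → ℝ) (φ : DirectMechanism n)
    (d : ReceiverStrategy n false) (t : Fin n) (ht : (t : ℕ) = 0) :
    ∑ θ, ∑ σ, φ.law θ σ * payoffFrom ρ d t θ σ =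
      utilityAt ρ φ d t 1 (fun _ => true) + utilityAt ρ φ d t 1 (fun _ => false) := by
  classical
  unfold utilityAt
  rw [← Finset.sum_add_distrib]
  refine Finset.sum_congr rfl fun θ _ => ?_
  rw [← Finset.sum_add_distrib]
  refine Finset.sum_congr rfl fun σ _ => ?_
  have iff : ∀ b, SameInfo false t 1 θ (fun _ => b) σ ↔ b = σ t := by
    intro b
    refine ⟨fun h => h.1 t le_rfl, fun h => ⟨fun s hs => ?_, by simp⟩⟩
    have hs : (s : ℕ) ≤ t := hs
    rw [h, show s = t from Fin.ext (by omega)]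
  simp only [iff]
  cases σ t <;> simp

/-- Compares obedience with always hiring at once. This is all that the upper bound needs from
persuasiveness. -/
theorem mean_le_of_persuasive {ρ : Fin n → ℝ} {φ : DirectMechanism n} (hn : 0 < n)
    (h : Persuasive false ρ φ) : receiverMean ρ Finset.univ ≤ senderUtility ρ φ := by
  have h0 : ∀ s : Fin n, ¬ s < ⟨0, hn⟩ := fun s hs => Nat.not_lt_zero _ hs
  have hpay : obedientPayoff ρ = payoffFrom ρ (obedient n false) ⟨0, hn⟩ :=
    obedientPayoff_eq_payoffAfter false ρ
  rw [← sum_law_mul_first φ ρ ⟨0, hn⟩ rfl, senderUtility, hpay, sum_law_mul_payoffFrom _ _ _ _ rfl,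
    sum_law_mul_payoffFrom _ _ _ _ rfl]
  exact add_le_add (h _ _ _ (fun s hs => absurd hs (h0 s)) _)
    (h _ _ _ (fun s hs => absurd hs (h0 s)) _)

/-! ### Persuasive mechanisms as lotteries -/

theorem obedientPayoff_eq_sum (u : Fin n → ℝ) (θ : Equiv.Perm (Fin n)) (σ : Fin n → Bool) :
    obedientPayoff u θ σ = ∑ i, obedientPayoff (Pi.single i 1) θ σ * u i := by
  classical
  unfold obedientPayoff
  simp only [Finset.sum_mul]
  rw [Finset.sum_comm]
  refine Finset.sum_congr rfl fun t _ => ?_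
  split_ifs <;> simp [Pi.single_apply]

/-- Here `senderUtility (Pi.single i 1) φ` is the probability that `i` is hired, so a mechanism
matters only through a subprobability on candidates. -/
theorem senderUtility_eq_sum (u : Fin n → ℝ) (φ : DirectMechanism n) :
    senderUtility u φ = ∑ i, senderUtility (Pi.single i 1) φ * u i := by
  unfold senderUtility
  simp only [Finset.sum_mul]
  conv_rhs => rw [Finset.sum_comm]
  refine Finset.sum_congr rfl fun θ _ => ?_
  conv_rhs => rw [Finset.sum_comm]
  refine Finset.sum_congr rfl fun σ _ => ?_
  rw [obedientPayoff_eq_sum, Finset.mul_sum]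
  simp only [mul_assoc]

theorem obedientPayoff_nonneg {u : Fin n → ℝ} (hu : ∀ i, 0 ≤ u i) (θ : Equiv.Perm (Fin n))
    (σ : Fin n → Bool) : 0 ≤ obedientPayoff u θ σ := by
  refine Finset.sum_nonneg fun t _ => ?_
  split_ifs
  · exact hu _
  · exact le_rfl

theorem senderUtility_nonneg {u : Fin n → ℝ} (hu : ∀ i, 0 ≤ u i) (φ : DirectMechanism n) :
    0 ≤ senderUtility u φ :=
  Finset.sum_nonneg fun θ _ => Finset.sum_nonneg fun σ _ =>
    mul_nonneg (φ.law_nonneg θ σ) (obedientPayoff_nonneg hu θ σ)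

theorem obedientPayoff_one_le (θ : Equiv.Perm (Fin n)) (σ : Fin n → Bool) :
    obedientPayoff (fun _ => 1) θ σ ≤ 1 := by
  classical
  unfold obedientPayoff
  rw [Finset.sum_boole]
  have : (Finset.univ.filter fun t => σ t = true ∧ ∀ s, s < t → σ s = false).card ≤ 1 := by
    refine Finset.card_le_one.2 fun t ht t' ht' => ?_
    simp only [Finset.mem_filter, Finset.mem_univ, true_and] at ht ht'
    by_contra hne
    rcases lt_or_gt_of_ne hne with h | h
    · simpa [ht.1] using ht'.2 t h
    · simpa [ht'.1] using ht.2 t' h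
  exact_mod_cast this

theorem sum_senderUtility_single_le (φ : DirectMechanism n) :
    ∑ i, senderUtility (Pi.single i 1) φ ≤ 1 := by
  have h := senderUtility_eq_sum (fun _ => 1) φ
  simp only [mul_one] at h
  rw [← h]
  refine le_of_le_of_eq ?_ (φ.sum_law_mul_const 1)
  exact Finset.sum_le_sum fun θ _ => Finset.sum_le_sum fun σ _ =>
    mul_le_mul_of_nonneg_left (obedientPayoff_one_le θ σ) (φ.law_nonneg θ σ)

theorem ParetoProcedure.senderUtility_le_returned {ρ ξ : Fin n → ℝ} (P : ParetoProcedure ρ ξ)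
    (hn : 0 < n) (hρ : ∀ i, 0 ≤ ρ i) (hξ : ∀ i, 0 ≤ ξ i) {φ : DirectMechanism n}
    (h : Persuasive false ρ φ) : senderUtility ξ φ ≤ P.returned ξ Finset.univ := by
  classical
  set x : Fin n → ℝ := fun i => senderUtility (Pi.single i 1) φ with hx
  have hx0 : ∀ i, 0 ≤ x i := fun i => senderUtility_nonneg (fun j => by
    rw [Pi.single_apply]; split_ifs <;> norm_num) φ
  have hx1 : ∑ i, x i ≤ 1 := sum_senderUtility_single_le φ
  let i₀ : Fin n := ⟨0, hn⟩
  -- give the probability of not hiring to some candidate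
  set y : Fin n → ℝ := fun i => x i + if i = i₀ then 1 - ∑ i, x i else 0 with hy
  have hysum : ∀ u : Fin n → ℝ, ∑ i, y i * u i =
      senderUtility u φ + (1 - ∑ i, x i) * u i₀ := by
    intro u
    simp only [hy, add_mul, Finset.sum_add_distrib, ite_mul, zero_mul, Finset.sum_ite_eq',
      Finset.mem_univ, if_true]
    rw [senderUtility_eq_sum u φ]
  have hy1 : ∑ i, y i = 1 := by
    simp only [hy, Finset.sum_add_distrib, Finset.sum_ite_eq', Finset.mem_univ, if_true]
    ring
  have hmain := P.sum_le_returned hξ (C := Finset.univ) ⟨i₀, Finset.mem_univ _⟩ (y := y)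
    (fun i _ => add_nonneg (hx0 i) (by split_ifs <;> linarith)) hy1 (by
      rw [hysum]
      have h1 := mean_le_of_persuasive hn h
      have h2 := mul_nonneg (sub_nonneg.2 hx1) (hρ i₀)
      linarith)
  rw [hysum] at hmain
  have := mul_nonneg (sub_nonneg.2 hx1) (hξ i₀)
  linarith

theorem ParetoProcedure.third_benchmarkOpt_le {ρ ξ : Fin n → ℝ} (P : ParetoProcedure ρ ξ)
    (hn : 0 < n) (hρ : ∀ i, 0 ≤ ρ i) (hξ : ∀ i, 0 ≤ ξ i) :
    1 / 3 * benchmarkOpt ρ ξ ≤ senderUtility ξ P.shrinkingPareto := by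
  have hopt : benchmarkOpt ρ ξ ≤ P.returned ξ Finset.univ := by
    refine (isLUB_benchmarkOpt ρ ξ hρ).2 ?_
    rintro _ ⟨φ, hφ, rfl⟩
    exact P.senderUtility_le_returned hn hρ hξ hφ
  have hval := P.factorial_mul_returned_le_value hξ n Finset.univ (by simp)
  have hfac : (0 : ℝ) < n.factorial := by exact_mod_cast n.factorial_pos
  rw [P.senderUtility_shrinkingPareto, one_div_mul_eq_div (n.factorial : ℝ), le_div_iff₀ hfac]
  nlinarith

end OnlinePersuasion

theorem mainTheorem7 :
    ∃ δ : ℕ → ℝ, Filter.Tendsto δ Filter.atTop (nhds 0) ∧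
      ∀ n : ℕ, 0 < n → ∀ ρ ξ : Fin n → ℝ, (∀ i, 0 ≤ ρ i) → (∀ i, 0 ≤ ξ i) →
        ∀ P : OnlinePersuasion.ParetoProcedure ρ ξ,
          OnlinePersuasion.Persuasive true ρ P.shrinkingPareto ∧
          (1 / 3 - δ n) * OnlinePersuasion.benchmarkOpt ρ ξ ≤
            OnlinePersuasion.senderUtility ξ P.shrinkingPareto := by
  -- The bound has no error term, so δ = 0 works.
  refine ⟨fun _ => 0, tendsto_const_nhds, fun n hn ρ ξ hρ hξ P =>
    ⟨P.persuasive_shrinkingPareto hρ, ?_⟩⟩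
  simpa using P.third_benchmarkOpt_le hn hρ hξ
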